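/- For each integer $Q\ge 1$ let $\mathcal S_Q$ be the set of matrices $\begin{pmatrix} a & b\\ c& d\end{pmatrix}\in \mathrm{SL}(2,\mathbb Z)$ with $a\ge b\ge d\ge 1$, $a\ge c\ge d$ and trace $a+d\le Q$, and let $$\mathfrak{SF}_Q:=\left\{\frac db : \begin{pmatrix} a & b\\ c& d\end{pmatrix}\in\mathcal S_Q\right\}\subset \mathbb Q\cap(0,1]$$ be the (finite) set of $\mathrm{SL}(2,\mathbb N)$-saturated Farey fractions of order $Q$, each fraction being counted once. Then for every $\beta\in[0,1]$, $$\lim_{Q\to\infty}\frac{\#\big(\mathfrak{SF}_Q\cap[0,\beta]\big)}{\#\mathfrak{SF}_Q}=\int_0^\beta\left(\frac1{1+x}-\frac1{2+x}\right)\frac{dx}{\log(4/3)} .$$ -/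

import Mathlib

open Matrix Filter Topology

/-- The monoid `𝒮` of matrices `(a b; c d) ∈ SL(2, ℤ)` with `a ≥ b ≥ d ≥ 1` and `a ≥ c ≥ d`. -/
def monoidS : Set (Matrix.SpecialLinearGroup (Fin 2) ℤ) :=
  {M | M.1 0 0 ≥ M.1 0 1 ∧ M.1 0 1 ≥ M.1 1 1 ∧ M.1 1 1 ≥ 1 ∧
    M.1 0 0 ≥ M.1 1 0 ∧ M.1 1 0 ≥ M.1 1 1}

/-- The matrices in `𝒮` of trace at most `Q`. -/
def traceS (Q : ℕ) : Set (Matrix.SpecialLinearGroup (Fin 2) ℤ) :=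
  {M | M ∈ monoidS ∧ M.1.trace ≤ (Q : ℤ)}

/-- The map `Ψ` sending `(a b; c d)` to the fraction `d / b`. -/
def fracPsi (M : Matrix.SpecialLinearGroup (Fin 2) ℤ) : ℚ :=
  (M.1 1 1 : ℚ) / (M.1 0 1 : ℚ)

/-- The set `𝔖𝔉_Q = Ψ(𝒮_Q)` of saturated Farey fractions of order `Q`. -/
def saturatedFarey (Q : ℕ) : Set ℚ := fracPsi '' traceS Q

/-- The set `𝔖𝔉_Q` is finite, so that counting its elements is meaningful. -/
theorem saturatedFarey_finite (Q : ℕ) : (saturatedFarey Q).Finite := by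
  refine (((Set.finite_Icc (1 : ℤ) Q).prod (Set.finite_Icc (1 : ℤ) Q)).image
    (fun p : ℤ × ℤ => (p.1 : ℚ) / (p.2 : ℚ))).subset ?_
  rintro _ ⟨M, ⟨⟨h1, h2, h3, h4, h5⟩, ht⟩, rfl⟩
  rw [Matrix.trace_fin_two] at ht
  refine ⟨(M.1 1 1, M.1 0 1), ⟨⟨?_, ?_⟩, ⟨?_, ?_⟩⟩, rfl⟩ <;> dsimp only <;> omega

/-! Let d/b < 1 come from a matrix in `traceS Q`. The determinant gives a·d ≡ 1 mod b, and a ≥ b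
then forces a ≥ b + d̄, where d̄ in [0, b) is the inverse of d modulo b. Conversely a = b + d̄ does
occur. So d/b is in the set exactly when b + d + d̄ ≤ Q, that is, b(1 + x + y) ≤ Q at the point (x,
y) = (d/b, d̄/b). Up to one element, the problem is to count coprime pairs under this condition and
x ≤ β (`ncard_saturatedFarey_le`, `hyperbolicCount_le_ncard`).

The points with b ≤ X equidistribute in the unit square (`tendsto_empiricalMeasure`). By Weyl's
criterion this needs Kloosterman sums with fixed frequencies, summed over moduli up to X, to be
o(X²), since there are about C·X² points with C = 1/(2ζ(2)) > 0. Weil's bound is not needed: outside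
a set of small density, q has a large prime factor p with p² ∤ q. Kloosterman's fourth moment bound
modulo p, with the trivial bound on the cofactor, is then enough
(`tendsto_sum_norm_zmodKloosterman`).

Cutting the square into thin slices on which 1 + x + y is nearly constant gives a count asymptotic
to C·Q² times the integral of (1 + x + y)⁻² over x ≤ β (`tendsto_hyperbolicCount`). Integrating over
y leaves 1/(1+x) − 1/(2+x), whose integral over [0, 1] is log(4/3). The constant C cancels in the
ratio. -/

/-! ### Kloosterman sums over finite rings and the fourth moment bound. -/

/-- The Kloosterman sum `∑ ψ (a u + b u⁻¹)` over the units of a finite commutative ring. -/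
noncomputable def kloostermanSum {R : Type*} [CommRing R] [Fintype Rˣ] (ψ : AddChar R ℂ)
    (a b : R) : ℂ :=
  ∑ u : Rˣ, ψ (a * u + b * (u⁻¹ : Rˣ))

/-- Substituting u ↦ tu. In the fourth moment over all frequencies, each sum is thus repeated along
a whole orbit of units. -/
theorem kloostermanSum_mul_unit {R : Type*} [CommRing R] [Fintype Rˣ] (ψ : AddChar R ℂ)
    (a b : R) (t : Rˣ) :
    kloostermanSum ψ (a * t) (b * (t⁻¹ : Rˣ)) = kloostermanSum ψ a b := by
  unfold kloostermanSum
  refine Fintype.sum_equiv (Equiv.mulLeft t) _ _ fun u => ?_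
  simp only [Equiv.coe_mulLeft, _root_.mul_inv_rev, Units.val_mul]
  congr 1
  ring

theorem norm_kloostermanSum_le_card {R : Type*} [CommRing R] [Finite R] [Fintype Rˣ]
    (ψ : AddChar R ℂ) (a b : R) : ‖kloostermanSum ψ a b‖ ≤ Fintype.card Rˣ := by
  refine (norm_sum_le _ _).trans ?_
  simp [AddChar.norm_apply]

section Field

variable {F : Type*} [Field F] [Fintype F] [DecidableEq F]

/-- Parseval's identity for exponential sums with frequencies in `F × F`. -/
theorem sum_norm_sq_addChar_sum {ι : Type*} [Fintype ι] {ψ : AddChar F ℂ} (hψ : ψ ≠ 1)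
    (v : ι → F × F) :
    ∑ a : F, ∑ b : F, ‖∑ i, ψ (a * (v i).1 + b * (v i).2)‖ ^ 2 =
      (Fintype.card F : ℝ) ^ 2 *
        (Finset.univ.filter fun p : ι × ι => v p.1 = v p.2).card := by
  have key : ∀ a b : F, ((‖∑ i, ψ (a * (v i).1 + b * (v i).2)‖ ^ 2 : ℝ) : ℂ) =
      ∑ p : ι × ι, ψ (a * ((v p.1).1 - (v p.2).1)) * ψ (b * ((v p.1).2 - (v p.2).2)) := by
    intro a b
    rw [Complex.ofReal_pow, ← Complex.mul_conj', map_sum, Finset.sum_mul_sum,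
      ← Finset.univ_product_univ, Finset.sum_product]
    refine Finset.sum_congr rfl fun i _ => Finset.sum_congr rfl fun j _ => ?_
    rw [← AddChar.map_neg_eq_conj, ← AddChar.map_add_eq_mul, ← AddChar.map_add_eq_mul]
    congr 1
    ring
  have hp := AddChar.IsPrimitive.of_ne_one hψ
  apply Complex.ofReal_injective
  rw [Complex.ofReal_sum]
  simp_rw [Complex.ofReal_sum, key]
  have h1 : ∀ a : F, ∑ b : F, ∑ p : ι × ι,
      ψ (a * ((v p.1).1 - (v p.2).1)) * ψ (b * ((v p.1).2 - (v p.2).2)) =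
      ∑ p : ι × ι, ψ (a * ((v p.1).1 - (v p.2).1)) *
        ∑ b : F, ψ (b * ((v p.1).2 - (v p.2).2)) := by
    intro a
    rw [Finset.sum_comm]
    simp_rw [Finset.mul_sum]
  simp_rw [h1]
  rw [Finset.sum_comm]
  simp_rw [← Finset.sum_mul, AddChar.sum_mulShift _ hp, sub_eq_zero]
  rw [Finset.card_filter]
  push_cast
  rw [Finset.mul_sum]
  refine Finset.sum_congr rfl fun p _ => ?_
  by_cases h : v p.1 = v p.2
  · simp [h, sq]
  · rw [if_neg h]
    rcases not_and_or.1 (fun h' => h (Prod.ext_iff.2 h')) with h' | h' <;> simp [h']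

/-- The additive energy of the hyperbola `x y = 1` over a finite field. -/
theorem card_hyperbola_energy_le :
    (Finset.univ.filter fun p : (Fˣ × Fˣ) × (Fˣ × Fˣ) =>
      (((p.1.1 : F) + p.1.2, ((p.1.1⁻¹ : Fˣ) : F) + (p.1.2⁻¹ : Fˣ)) : F × F) =
        ((p.2.1 : F) + p.2.2, ((p.2.1⁻¹ : Fˣ) : F) + (p.2.2⁻¹ : Fˣ))).card ≤
      3 * Fintype.card Fˣ ^ 2 := by
  let f₁ : Fˣ × Fˣ → (Fˣ × Fˣ) × (Fˣ × Fˣ) := fun u => (u, u)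
  let f₂ : Fˣ × Fˣ → (Fˣ × Fˣ) × (Fˣ × Fˣ) := fun u => (u, (u.2, u.1))
  let f₃ : Fˣ × Fˣ → (Fˣ × Fˣ) × (Fˣ × Fˣ) := fun u => ((u.1, -u.1), (u.2, -u.2))
  have hc : ∀ f : Fˣ × Fˣ → (Fˣ × Fˣ) × (Fˣ × Fˣ),
      (Finset.univ.image f).card ≤ Fintype.card Fˣ ^ 2 := fun f =>
    Finset.card_image_le.trans (by simp [sq])
  refine (Finset.card_le_card (t := Finset.univ.image f₁ ∪ (Finset.univ.image f₂ ∪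
    Finset.univ.image f₃)) ?_).trans ?_
  · rintro ⟨⟨u, v⟩, ⟨w, z⟩⟩ h
    simp only [Finset.mem_filter, Finset.mem_univ, true_and, Prod.mk.injEq,
      Units.val_inv_eq_inv_val] at h
    obtain ⟨h1, h2⟩ := h
    have hu := u.ne_zero
    have hv := v.ne_zero
    have hw := w.ne_zero
    have hz := z.ne_zero
    field_simp at h2
    -- Equal sums and equal sums of inverses leave two cases: both sums vanish (`f₃`), or the
    -- products also agree and {u, v} = {w, z} (`f₁`, `f₂`).
    have h3 : ((u : F) + v) * ((u : F) * v - w * z) = 0 := by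
      rw [add_comm (v : F), add_comm (z : F), ← h1] at h2
      linear_combination -h2
    simp only [Finset.mem_union, Finset.mem_image, Finset.mem_univ, true_and, Prod.exists, f₁, f₂,
      f₃, Prod.mk.injEq]
    rcases mul_eq_zero.1 h3 with h3 | h3
    · right; right
      refine ⟨u, w, ⟨rfl, ?_⟩, rfl, ?_⟩ <;> apply Units.ext <;> rw [Units.val_neg]
      · linear_combination -h3
      · linear_combination h1 - h3
    · have h4 : ((u : F) - w) * ((u : F) - z) = 0 := by
        linear_combination (u : F) * h1 - h3
      rcases mul_eq_zero.1 h4 with h4 | h4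
      · left
        have e1 : u = w := Units.ext (sub_eq_zero.1 h4)
        subst e1
        refine ⟨u, v, ⟨rfl, rfl⟩, rfl, Units.ext ?_⟩
        linear_combination h1
      · right; left
        have e1 : u = z := Units.ext (sub_eq_zero.1 h4)
        subst e1
        refine ⟨u, v, ⟨rfl, rfl⟩, Units.ext ?_, rfl⟩
        linear_combination h1
  · refine (Finset.card_union_le _ _).trans ?_
    have := Finset.card_union_le (Finset.univ.image f₂) (Finset.univ.image f₃)
    have := hc f₁
    have := hc f₂
    have := hc f₃
    omega

/-- Kloosterman's bound over a finite field. -/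
theorem norm_kloostermanSum_pow_four_le {ψ : AddChar F ℂ} (hψ : ψ ≠ 1) {a b : F}
    (hab : a ≠ 0 ∨ b ≠ 0) :
    ‖kloostermanSum ψ a b‖ ^ 4 ≤ 3 * (Fintype.card F : ℝ) ^ 2 * Fintype.card Fˣ := by
  have hsq : ∀ a b : F, ‖kloostermanSum ψ a b‖ ^ 4 =
      ‖∑ i : Fˣ × Fˣ, ψ (a * ((i.1 : F) + i.2) +
        b * (((i.1⁻¹ : Fˣ) : F) + (i.2⁻¹ : Fˣ)))‖ ^ 2 := by
    intro a b
    rw [show (4 : ℕ) = 2 * 2 from rfl, pow_mul, ← norm_pow]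
    congr 2
    rw [kloostermanSum, sq, Finset.sum_mul_sum, ← Finset.univ_product_univ, Finset.sum_product]
    refine Finset.sum_congr rfl fun i _ => Finset.sum_congr rfl fun j _ => ?_
    rw [← AddChar.map_add_eq_mul]
    congr 1
    ring
  have hparseval := sum_norm_sq_addChar_sum hψ
    (fun i : Fˣ × Fˣ => ((i.1 : F) + i.2, ((i.1⁻¹ : Fˣ) : F) + (i.2⁻¹ : Fˣ)))
  simp only [← hsq] at hparseval
  have hE : ((Finset.univ.filter fun p : (Fˣ × Fˣ) × (Fˣ × Fˣ) =>
      (((p.1.1 : F) + p.1.2, ((p.1.1⁻¹ : Fˣ) : F) + (p.1.2⁻¹ : Fˣ)) : F × F) =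
        ((p.2.1 : F) + p.2.2, ((p.2.1⁻¹ : Fˣ) : F) + (p.2.2⁻¹ : Fˣ))).card : ℝ) ≤
      3 * (Fintype.card Fˣ : ℝ) ^ 2 := by exact_mod_cast card_hyperbola_energy_le (F := F)
  have hpos : (0 : ℝ) < Fintype.card Fˣ := by exact_mod_cast Fintype.card_pos
  -- A nonzero frequency has a free orbit under the units, so its fourth power occurs `card Fˣ`
  -- times in the complete moment.
  let g : Fˣ → F × F := fun t => (a * t, b * (t⁻¹ : Fˣ))
  have hg : Function.Injective g := by
    intro s t hst
    simp only [g, Prod.mk.injEq] at hst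
    rcases hab with h | h
    · exact Units.ext (mul_left_cancel₀ h hst.1)
    · exact inv_injective (Units.ext (mul_left_cancel₀ h hst.2))
  have horbit : (Fintype.card Fˣ : ℝ) * ‖kloostermanSum ψ a b‖ ^ 4 ≤
      ∑ a : F, ∑ b : F, ‖kloostermanSum ψ a b‖ ^ 4 := by
    rw [← Fintype.sum_prod_type' (f := fun a b => ‖kloostermanSum ψ a b‖ ^ 4)]
    calc (Fintype.card Fˣ : ℝ) * ‖kloostermanSum ψ a b‖ ^ 4
        = ∑ t : Fˣ, ‖kloostermanSum ψ (g t).1 (g t).2‖ ^ 4 := by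
          simp only [g, kloostermanSum_mul_unit, Finset.sum_const, Finset.card_univ, nsmul_eq_mul]
      _ = ∑ x ∈ Finset.univ.map ⟨g, hg⟩, ‖kloostermanSum ψ x.1 x.2‖ ^ 4 := by
          rw [Finset.sum_map]; rfl
      _ ≤ _ := Finset.sum_le_sum_of_subset_of_nonneg (Finset.subset_univ _)
          fun _ _ _ => by positivity
  rw [hparseval] at horbit
  have h2 : (Fintype.card Fˣ : ℝ) * ‖kloostermanSum ψ a b‖ ^ 4 ≤
      Fintype.card Fˣ * (3 * (Fintype.card F : ℝ) ^ 2 * Fintype.card Fˣ) := by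
    refine horbit.trans ((mul_le_mul_of_nonneg_left hE (by positivity)).trans_eq ?_)
    ring
  exact le_of_mul_le_mul_left h2 hpos

end Field

/-- A Kloosterman sum over `R × S` is at most its factor over `R` times the trivial bound. -/
theorem norm_kloostermanSum_prod_le {R S : Type*} [CommRing R] [CommRing S] [Finite S] [Finite R]
    [Fintype Rˣ] [Fintype Sˣ] [Fintype (R × S)ˣ] (ψ : AddChar (R × S) ℂ) (a b : R × S) :
    ‖kloostermanSum ψ a b‖ ≤ Fintype.card Sˣ *
      ‖kloostermanSum (ψ.compAddMonoidHom (AddMonoidHom.inl R S)) a.1 b.1‖ := by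
  have h : kloostermanSum ψ a b =
      kloostermanSum (ψ.compAddMonoidHom (AddMonoidHom.inl R S)) a.1 b.1 *
      kloostermanSum (ψ.compAddMonoidHom (AddMonoidHom.inr R S)) a.2 b.2 := by
    unfold kloostermanSum
    rw [Finset.sum_mul_sum, ← Finset.sum_product', Finset.univ_product_univ]
    refine Fintype.sum_equiv MulEquiv.prodUnits.toEquiv _ _ fun u => ?_
    rw [AddChar.compAddMonoidHom_apply, AddChar.compAddMonoidHom_apply, ← AddChar.map_add_eq_mul]
    congr 1
    ext <;> simp [MulEquiv.prodUnits]
  rw [h, norm_mul, mul_comm]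
  gcongr
  exact norm_kloostermanSum_le_card _ _ _

theorem kloostermanSum_ringEquiv {R S : Type*} [CommRing R] [CommRing S] [Fintype Rˣ] [Fintype Sˣ]
    (e : R ≃+* S) (ψ : AddChar S ℂ) (a b : R) :
    kloostermanSum (ψ.compAddMonoidHom (e : R →+ S)) a b = kloostermanSum ψ (e a) (e b) := by
  unfold kloostermanSum
  refine Fintype.sum_equiv (Units.mapEquiv e.toMulEquiv).toEquiv _ _ fun u => ?_
  rw [AddChar.compAddMonoidHom_apply]
  congr 1
  simp [← map_inv]

/-- The Chinese remainder theorem splits off the factor modulo p, which satisfies K⁴ ≤ 3p²(p − 1);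
the factor modulo r is bounded trivially. Relative to φ(pr)⁴ the saving is 3p²/(p − 1)³, of order
1/p. -/
theorem norm_kloostermanSum_mul_le {p r : ℕ} [Fact p.Prime] [NeZero r] [NeZero (p * r)]
    (hpr : p.Coprime r) (m n : ℤ) (hmn : ¬ ((p : ℤ) ∣ m ∧ (p : ℤ) ∣ n)) :
    ‖kloostermanSum (ZMod.stdAddChar (N := p * r)) m n‖ ^ 4 * ((p : ℝ) - 1) ^ 3 ≤
      3 * (p : ℝ) ^ 2 * ((p * r).totient : ℝ) ^ 4 := by
  let e := ZMod.chineseRemainder hpr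
  let ψ : AddChar (ZMod p × ZMod r) ℂ :=
    (ZMod.stdAddChar (N := p * r)).compAddMonoidHom (e.symm : _ →+ ZMod (p * r))
  have h1 : kloostermanSum (ZMod.stdAddChar (N := p * r)) m n = kloostermanSum ψ m n := by
    have := kloostermanSum_ringEquiv e.symm (ZMod.stdAddChar (N := p * r)) m n
    rw [map_intCast, map_intCast] at this
    exact this.symm
  -- The standard character is injective, so its restriction to the p-component is nontrivial.
  have hψ : ψ.compAddMonoidHom (AddMonoidHom.inl (ZMod p) (ZMod r)) ≠ 1 := by
    intro h
    have h3 := DFunLike.congr_fun h 1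
    simp only [ψ, AddChar.compAddMonoidHom_apply, AddChar.one_apply] at h3
    have h4 := (ZMod.injective_stdAddChar (N := p * r)) (h3.trans (AddChar.map_zero_eq_one _).symm)
    have h5 : ((AddMonoidHom.inl (ZMod p) (ZMod r)) 1) = 0 := by
      apply e.symm.injective
      rw [map_zero]; exact h4
    exact one_ne_zero (congrArg Prod.fst h5)
  have h2 := norm_kloostermanSum_prod_le ψ (m : ZMod p × ZMod r) n
  have hp1 : 1 ≤ p := (Fact.out : p.Prime).one_lt.le
  have h3 := norm_kloostermanSum_pow_four_le hψ (a := (m : ZMod p × ZMod r).1)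
    (b := (n : ZMod p × ZMod r).1) (by
      simp only [Prod.fst_intCast, ne_eq, ZMod.intCast_zmod_eq_zero_iff_dvd]
      tauto)
  rw [h1]
  rw [ZMod.card, ZMod.card_units_eq_totient, Nat.totient_prime Fact.out, Nat.cast_sub hp1,
    Nat.cast_one] at h3
  rw [ZMod.card_units_eq_totient] at h2
  rw [Nat.totient_mul hpr, Nat.totient_prime Fact.out, Nat.cast_mul, Nat.cast_sub hp1,
    Nat.cast_one]
  have hp2 : (0 : ℝ) ≤ (p : ℝ) - 1 := by
    have : (1 : ℝ) ≤ p := by exact_mod_cast hp1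
    linarith
  set K := ‖kloostermanSum (ψ.compAddMonoidHom (AddMonoidHom.inl (ZMod p) (ZMod r)))
    (m : ZMod p × ZMod r).1 (n : ZMod p × ZMod r).1‖
  calc _ ≤ ((r.totient : ℝ) * K) ^ 4 * ((p : ℝ) - 1) ^ 3 := by gcongr
    _ = (r.totient : ℝ) ^ 4 * ((p : ℝ) - 1) ^ 3 * K ^ 4 := by ring
    _ ≤ (r.totient : ℝ) ^ 4 * ((p : ℝ) - 1) ^ 3 * (3 * (p : ℝ) ^ 2 * (p - 1)) := by gcongr
    _ = _ := by ring

/-! ### Averages of Kloosterman sums over the modulus. -/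

/-- The Kloosterman sum modulo `q` with integer frequencies (zero for `q = 0`). -/
noncomputable def zmodKloosterman (m n : ℤ) (q : ℕ) : ℂ :=
  if h : q = 0 then 0 else
    haveI : NeZero q := ⟨h⟩
    kloostermanSum (ZMod.stdAddChar (N := q)) m n

theorem zmodKloosterman_of_neZero (m n : ℤ) (q : ℕ) [NeZero q] :
    zmodKloosterman m n q = kloostermanSum (ZMod.stdAddChar (N := q)) m n := by
  rw [zmodKloosterman, dif_neg (NeZero.ne q)]

theorem norm_zmodKloosterman_le_totient (m n : ℤ) (q : ℕ) :
    ‖zmodKloosterman m n q‖ ≤ q.totient := by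
  rcases eq_or_ne q 0 with rfl | h
  · simp [zmodKloosterman]
  · have : NeZero q := ⟨h⟩
    rw [zmodKloosterman_of_neZero, ← ZMod.card_units_eq_totient]
    exact norm_kloostermanSum_le_card _ _ _

theorem norm_zmodKloosterman_le (m n : ℤ) (q : ℕ) : ‖zmodKloosterman m n q‖ ≤ q :=
  (norm_zmodKloosterman_le_totient m n q).trans (by exact_mod_cast Nat.totient_le q)

/-- If a large prime divides `q` exactly once, Kloosterman sums modulo `q` are small. -/
theorem exists_norm_zmodKloosterman_le_mul {m n : ℤ} (hmn : m ≠ 0 ∨ n ≠ 0) {ε : ℝ} (hε : 0 < ε) :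
    ∃ P : ℕ, ∀ P' : ℕ, P ≤ P' → ∀ q p : ℕ, p.Prime → P' < p → p ∣ q → ¬ p ^ 2 ∣ q →
      ‖zmodKloosterman m n q‖ ≤ ε * q := by
  -- A prime above |m| and |n| cannot divide a nonzero frequency; above 2 it satisfies p ≤ 2(p − 1),
  -- so p³ ≤ 8(p − 1)³; and 24 = 3 · 8 is what ε⁴p must then exceed.
  obtain ⟨P, hP⟩ := exists_nat_gt (max (24 / ε ^ 4) (max (2 : ℝ) (max |(m : ℝ)| |(n : ℝ)|)))
  simp only [max_lt_iff] at hP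
  obtain ⟨hP1, hP2, hPm, hPn⟩ := hP
  refine ⟨P, fun P' hPP q p hp hPp hpq hpq2 => ?_⟩
  have hPp' : (P : ℝ) < p := by exact_mod_cast hPP.trans_lt hPp
  obtain ⟨r, rfl⟩ := hpq
  rcases eq_or_ne r 0 with rfl | hr
  · simp [zmodKloosterman]
  have : Fact p.Prime := ⟨hp⟩
  have : NeZero r := ⟨hr⟩
  have : NeZero (p * r) := ⟨mul_ne_zero hp.ne_zero hr⟩
  have hcop : p.Coprime r := (Nat.Prime.coprime_iff_not_dvd hp).2 fun h => hpq2 (by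
    rw [sq]; exact Nat.mul_dvd_mul_left p h)
  have hsmall : ∀ k : ℤ, |(k : ℝ)| < P → (p : ℤ) ∣ k → k = 0 := by
    intro k hk hd
    refine Int.eq_zero_of_abs_lt_dvd hd ?_
    have : |(k : ℝ)| < p := hk.trans hPp'
    exact_mod_cast this
  have hnd : ¬ ((p : ℤ) ∣ m ∧ (p : ℤ) ∣ n) := fun h => by
    rcases hmn with h' | h'
    · exact h' (hsmall m hPm h.1)
    · exact h' (hsmall n hPn h.2)
  have hK := norm_kloostermanSum_mul_le hcop m n hnd
  rw [← zmodKloosterman_of_neZero] at hK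
  set K := ‖zmodKloosterman m n (p * r)‖
  have hφ : ((p * r).totient : ℝ) ≤ (p * r : ℕ) := by exact_mod_cast Nat.totient_le _
  have hp2 : (2 : ℝ) < p := hP2.trans hPp'
  have h24 : 24 ≤ ε ^ 4 * p := by
    rw [div_lt_iff₀ (by positivity)] at hP1
    nlinarith [pow_pos hε 4]
  have h8 : (p : ℝ) ^ 3 ≤ 8 * ((p : ℝ) - 1) ^ 3 := by
    have : (p : ℝ) ≤ 2 * (p - 1) := by linarith
    calc (p : ℝ) ^ 3 ≤ (2 * ((p : ℝ) - 1)) ^ 3 := by gcongr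
      _ = _ := by ring
  have hKK : K ^ 4 * (p : ℝ) ^ 3 ≤ (ε * (p * r : ℕ)) ^ 4 * (p : ℝ) ^ 3 := by
    calc K ^ 4 * (p : ℝ) ^ 3 ≤ K ^ 4 * (8 * ((p : ℝ) - 1) ^ 3) := by gcongr
      _ = 8 * (K ^ 4 * ((p : ℝ) - 1) ^ 3) := by ring
      _ ≤ 8 * (3 * (p : ℝ) ^ 2 * ((p * r).totient : ℝ) ^ 4) := by gcongr
      _ ≤ 8 * (3 * (p : ℝ) ^ 2 * ((p * r : ℕ) : ℝ) ^ 4) := by gcongr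
      _ = 24 * ((p : ℝ) ^ 2 * ((p * r : ℕ) : ℝ) ^ 4) := by ring
      _ ≤ ε ^ 4 * p * ((p : ℝ) ^ 2 * ((p * r : ℕ) : ℝ) ^ 4) := by gcongr
      _ = _ := by ring
  exact le_of_pow_le_pow_left₀ (by norm_num) (by positivity)
    (le_of_mul_le_mul_right hKK (by positivity))

open Classical in
/-- The integers up to `X` divisible by the square of an integer exceeding `P`. -/
theorem card_exists_sq_dvd_le (P X : ℕ) (hP : P ≠ 0) :
    (((Finset.Ioc 0 X).filter fun q => ∃ p, P < p ∧ p ^ 2 ∣ q).card : ℝ) ≤ X / P := by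
  have hsub : ((Finset.Ioc 0 X).filter fun q => ∃ p, P < p ∧ p ^ 2 ∣ q) ⊆
      (Finset.Ioc P X).biUnion fun p => (Finset.Ioc 0 X).filter fun q => p ^ 2 ∣ q := by
    intro q hq
    simp only [Finset.mem_filter, Finset.mem_Ioc, Finset.mem_biUnion] at hq ⊢
    obtain ⟨⟨hq0, hqX⟩, p, hp, hpq⟩ := hq
    refine ⟨p, ⟨hp, ?_⟩, ⟨hq0, hqX⟩, hpq⟩
    exact ((Nat.le_self_pow two_ne_zero p).trans (Nat.le_of_dvd hq0 hpq)).trans hqX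
  have h1 : (((Finset.Ioc 0 X).filter fun q => ∃ p, P < p ∧ p ^ 2 ∣ q).card : ℝ) ≤
      ∑ p ∈ Finset.Ioc P X, (X : ℝ) * ((p : ℝ) ^ 2)⁻¹ := by
    refine (Nat.cast_le.2 ((Finset.card_le_card hsub).trans Finset.card_biUnion_le)).trans ?_
    push_cast
    refine Finset.sum_le_sum fun p _ => ?_
    rw [Nat.Ioc_filter_dvd_card_eq_div, ← div_eq_mul_inv]
    exact_mod_cast Nat.cast_div_le (α := ℝ) (m := X) (n := p ^ 2)
  refine h1.trans ?_
  rw [← Finset.mul_sum, div_eq_mul_inv]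
  gcongr
  rcases le_or_gt P X with h | h
  · refine (sum_Ioc_inv_sq_le_sub hP h).trans ?_
    simp
  · rw [Finset.Ioc_eq_empty (by omega)]; simp

/-- Kloosterman sums with a fixed nonzero frequency are small on average over the modulus. -/
theorem tendsto_sum_norm_zmodKloosterman {m n : ℤ} (hmn : m ≠ 0 ∨ n ≠ 0) :
    Tendsto (fun X : ℕ => (∑ q ∈ Finset.Ioc 0 X, ‖zmodKloosterman m n q‖) / (X : ℝ) ^ 2)
      atTop (𝓝 0) := by
  classical
  rw [Metric.tendsto_atTop]
  intro ε hε
  obtain ⟨P₀, hP₀⟩ := exists_norm_zmodKloosterman_le_mul hmn (ε := ε / 4) (by positivity)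
  obtain ⟨P₁, hP₁⟩ := exists_nat_gt (4 / ε)
  set P := max P₀ P₁ with hPdef
  have hP1 : 4 / ε < (P : ℝ) := hP₁.trans_le (by exact_mod_cast le_max_right _ _)
  have hP0 : (0 : ℝ) < P := lt_trans (by positivity) hP1
  set D : ℝ := 2 ^ (P + 1).primesBelow.card with hD
  obtain ⟨N, hN⟩ := exists_nat_gt ((4 * D / ε) ^ 2)
  refine ⟨N + 1, fun X hX => ?_⟩
  have hXN : (N : ℝ) < X := by exact_mod_cast hX
  have hX0 : (0 : ℝ) < X := lt_of_le_of_lt (Nat.cast_nonneg _) hXN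
  -- Outside `B₁` and `B₂`, q has a prime factor above P that divides it exactly once. `B₁` has at
  -- most X/P elements and `B₂`, the P-smooth numbers, at most D√X; both sizes are below εX/4.
  let B₁ := (Finset.Ioc 0 X).filter fun q => ∃ p, P < p ∧ p ^ 2 ∣ q
  let B₂ := X.smoothNumbersUpTo (P + 1)
  have hbound : ∀ q ∈ Finset.Ioc 0 X, ‖zmodKloosterman m n q‖ ≤
      ε / 4 * X + (if q ∈ B₁ then (X : ℝ) else 0) + (if q ∈ B₂ then (X : ℝ) else 0) := by
    intro q hq
    have hqX : (q : ℝ) ≤ X := by exact_mod_cast (Finset.mem_Ioc.1 hq).2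
    have hK := norm_zmodKloosterman_le m n q
    by_cases h1 : q ∈ B₁
    · rw [if_pos h1]
      have : (0 : ℝ) ≤ if q ∈ B₂ then (X : ℝ) else 0 := by split_ifs <;> positivity
      have : 0 ≤ ε / 4 * X := by positivity
      linarith
    by_cases h2 : q ∈ B₂
    · rw [if_pos h2, if_neg h1]
      have : 0 ≤ ε / 4 * X := by positivity
      linarith
    rw [if_neg h1, if_neg h2]
    simp only [B₁, Finset.mem_filter, hq, true_and, not_exists, not_and] at h1
    simp only [B₂, Nat.mem_smoothNumbersUpTo, (Finset.mem_Ioc.1 hq).2, true_and,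
      Nat.mem_smoothNumbers', not_forall, not_lt] at h2
    obtain ⟨p, hp, hpq, hpP⟩ := h2
    have := hP₀ P (le_max_left _ _) q p hp hpP hpq (h1 p hpP)
    have : ε / 4 * q ≤ ε / 4 * X := by gcongr
    linarith
  have hsum := Finset.sum_le_sum hbound
  rw [Finset.sum_add_distrib, Finset.sum_add_distrib, Finset.sum_const, Finset.sum_ite_mem,
    Finset.sum_ite_mem, Finset.sum_const, Finset.sum_const, Nat.card_Ioc] at hsum
  simp only [nsmul_eq_mul, Nat.sub_zero] at hsum
  have hc1 : ((Finset.Ioc 0 X ∩ B₁).card : ℝ) ≤ ε / 4 * X := by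
    refine (Nat.cast_le.2 (Finset.card_le_card Finset.inter_subset_right)).trans
      ((card_exists_sq_dvd_le P X (by exact_mod_cast hP0.ne')).trans ?_)
    rw [div_le_iff₀ hP0]
    rw [div_lt_iff₀ hε] at hP1
    nlinarith
  have hc2 : ((Finset.Ioc 0 X ∩ B₂).card : ℝ) ≤ ε / 4 * X := by
    refine (Nat.cast_le.2 ((Finset.card_le_card Finset.inter_subset_right).trans
      (Nat.smoothNumbersUpTo_card_le X (P + 1)))).trans ?_
    push_cast
    have hs : (Nat.sqrt X : ℝ) ≤ √X := Real.nat_sqrt_le_real_sqrt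
    have hs2 : 4 * D / ε ≤ √X := Real.le_sqrt_of_sq_le (hN.trans hXN).le
    have hs3 : D ≤ ε / 4 * √X := by
      rw [div_le_iff₀ hε] at hs2
      linarith
    calc D * Nat.sqrt X ≤ ε / 4 * √X * √X := by gcongr
      _ = ε / 4 * X := by rw [mul_assoc, Real.mul_self_sqrt hX0.le]
  have hnn : 0 ≤ (∑ q ∈ Finset.Ioc 0 X, ‖zmodKloosterman m n q‖) / (X : ℝ) ^ 2 :=
    div_nonneg (Finset.sum_nonneg fun _ _ => norm_nonneg _) (by positivity)
  rw [Real.dist_eq, sub_zero, abs_of_nonneg hnn, div_lt_iff₀ (by positivity)]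
  have h3 := mul_le_mul_of_nonneg_right hc1 hX0.le
  have h4 := mul_le_mul_of_nonneg_right hc2 hX0.le
  have h5 : 0 < ε * (X : ℝ) ^ 2 := by positivity
  nlinarith

/-! ### The number of coprime pairs: sums of the totient function. -/

/-- The constant `1 / (2 ζ(2))` in the asymptotic formula for sums of Euler's totient function. -/
noncomputable def totientConst : ℝ :=
  ∑' d : ℕ, (ArithmeticFunction.moebius d : ℝ) / (2 * (d : ℝ) ^ 2)

/-- The Dirichlet series of μ at 2 equals twice the constant, and its product with ζ(2) is 1. -/
theorem totientConst_ne_zero : totientConst ≠ 0 := by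
  intro h
  have h2 : (1 : ℝ) < (2 : ℂ).re := by norm_num
  have h1 := ArithmeticFunction.LSeries_zeta_mul_Lseries_moebius h2
  have h3 : LSeries (fun n => ((ArithmeticFunction.moebius n : ℤ) : ℂ)) 2 =
      ((2 * totientConst : ℝ) : ℂ) := by
    rw [totientConst, ← tsum_mul_left, Complex.ofReal_tsum, LSeries]
    refine tsum_congr fun d => ?_
    rcases eq_or_ne d 0 with rfl | hd
    · simp
    · rw [LSeries.term_of_ne_zero hd]
      push_cast
      have : ((d : ℂ)) ≠ 0 := by exact_mod_cast hd
      field_simp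
      norm_cast
  rw [h3, h] at h1
  simp at h1

/-- Expands φ = μ * id; the sum over multiples of d is a triangular number. Terms with d > X vanish,
so an infinite sum suited to dominated convergence can be used. -/
theorem sum_totient_Ioc_eq (X : ℕ) :
    (∑ n ∈ Finset.Ioc 0 X, (n.totient : ℝ)) =
      ∑' d : ℕ, (ArithmeticFunction.moebius d : ℝ) * ((X / d : ℕ) * ((X / d : ℕ) + 1) / 2) := by
  have h1 : ∀ n ∈ Finset.Ioc 0 X, (n.totient : ℝ) =
      ((ArithmeticFunction.moebius : ArithmeticFunction ℝ) *
        ((ArithmeticFunction.id : ArithmeticFunction ℕ) : ArithmeticFunction ℝ)) n := by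
    intro n hn
    have h := (ArithmeticFunction.sum_eq_iff_sum_mul_moebius_eq (R := ℝ)
      (f := fun n => (n.totient : ℝ)) (g := fun n => (n : ℝ))).1
      (fun n _ => by exact_mod_cast Nat.sum_totient n) n (Finset.mem_Ioc.1 hn).1
    rw [ArithmeticFunction.mul_apply, ← h]
    simp
  rw [Finset.sum_congr rfl h1, ArithmeticFunction.sum_Ioc_mul_eq_sum_sum, tsum_eq_sum]
  · refine Finset.sum_congr rfl fun d _ => ?_
    congr 1
    have h2 : ∀ k : ℕ, ∑ n ∈ Finset.Ioc 0 k,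
        ((ArithmeticFunction.id : ArithmeticFunction ℕ) : ArithmeticFunction ℝ) n =
          (k : ℝ) * (k + 1) / 2 := by
      intro k
      induction k with
      | zero => simp
      | succ k ih =>
        rw [Finset.sum_Ioc_succ_top (Nat.zero_le k), ih]
        simp
        ring
    exact h2 _
  · intro d hd
    rcases eq_or_ne d 0 with rfl | hd0
    · simp
    · have : X / d = 0 := Nat.div_eq_of_lt (by
        simp only [Finset.mem_Ioc, not_and, not_le] at hd
        omega)
      simp [this]

/-- Dominated convergence: the d-th term tends to μ(d)/(2d²) and is at most 1/d², because k(k + 1)/2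
≤ k² for natural k. -/
theorem tendsto_sum_totient_div_sq :
    Tendsto (fun X : ℕ => (∑ n ∈ Finset.Ioc 0 X, (n.totient : ℝ)) / (X : ℝ) ^ 2) atTop
      (𝓝 totientConst) := by
  simp_rw [sum_totient_Ioc_eq, ← tsum_div_const]
  refine tendsto_tsum_of_dominated_convergence (bound := fun d : ℕ => 1 / (d : ℝ) ^ 2)
    (Real.summable_one_div_nat_pow.2 one_lt_two) (fun d => ?_) ?_
  · rcases eq_or_ne d 0 with rfl | hd
    · simp
    have h1 : Tendsto (fun X : ℕ => ((X / d : ℕ) : ℝ) / X) atTop (𝓝 (1 / d)) := by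
      have := (tendsto_nat_floor_mul_div_atTop (R := ℝ) (a := 1 / d) (by positivity)).comp
        tendsto_natCast_atTop_atTop
      refine this.congr fun X => ?_
      simp only [Function.comp_apply]
      rw [one_div_mul_eq_div, Nat.floor_div_eq_div]
    have h2 : Tendsto (fun X : ℕ => 1 / (X : ℝ)) atTop (𝓝 0) := tendsto_one_div_atTop_nhds_zero_nat
    have h3 := ((h1.mul (h1.add h2)).div_const 2).const_mul (ArithmeticFunction.moebius d : ℝ)
    have hl : (ArithmeticFunction.moebius d : ℝ) * (1 / d * (1 / d + 0) / 2) =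
        (ArithmeticFunction.moebius d : ℝ) / (2 * (d : ℝ) ^ 2) := by
      field_simp; ring
    rw [hl] at h3
    refine h3.congr fun X => ?_
    rcases eq_or_ne X 0 with rfl | hX
    · simp
    · field_simp
  · refine Eventually.of_forall fun X d => ?_
    rcases eq_or_ne X 0 with rfl | hX
    · simp
    rcases eq_or_ne d 0 with rfl | hd
    · simp
    have hm : ‖(ArithmeticFunction.moebius d : ℝ)‖ ≤ 1 := by
      rw [Real.norm_eq_abs]
      exact_mod_cast ArithmeticFunction.abs_moebius_le_one
    have hk : ((X / d : ℕ) : ℝ) ≤ X / d := Nat.cast_div_le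
    have hk2 : ((X / d : ℕ) : ℝ) ≤ ((X / d : ℕ) : ℝ) ^ 2 := by
      exact_mod_cast Nat.le_self_pow two_ne_zero _
    have hk3 : ((X / d : ℕ) : ℝ) ^ 2 ≤ (X / d) ^ 2 := by gcongr
    rw [norm_div, norm_mul, Real.norm_of_nonneg (by positivity : (0 : ℝ) ≤ (X : ℝ) ^ 2),
      Real.norm_of_nonneg
        (by positivity : (0 : ℝ) ≤ (X / d : ℕ) * ((X / d : ℕ) + 1) / 2)]
    rw [div_le_iff₀ (by positivity)]
    calc _ ≤ 1 * (((X / d : ℕ) : ℝ) * ((X / d : ℕ) + 1) / 2) := by gcongr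
      _ ≤ (X / d) ^ 2 := by nlinarith
      _ = _ := by field_simp

theorem totientConst_pos : 0 < totientConst :=
  lt_of_le_of_ne (ge_of_tendsto' tendsto_sum_totient_div_sq fun _ =>
    div_nonneg (Finset.sum_nonneg fun _ _ => Nat.cast_nonneg _) (by positivity))
    totientConst_ne_zero.symm

/-! ### Weyl's criterion on the torus and on the unit cube. -/

open MeasureTheory in
/-- Weyl's criterion on the torus, for convergence of probability measures. -/
theorem tendsto_probabilityMeasure_unitAddTorus {d ι : Type*} [Fintype d] {l : Filter ι}
    {μs : ι → ProbabilityMeasure (UnitAddTorus d)} {ν : ProbabilityMeasure (UnitAddTorus d)}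
    (h : ∀ n : d → ℤ, Tendsto (fun i => ∫ x, UnitAddTorus.mFourier n x ∂(μs i : Measure _)) l
      (𝓝 (∫ x, UnitAddTorus.mFourier n x ∂(ν : Measure _)))) :
    Tendsto μs l (𝓝 ν) := by
  have hint : ∀ (μ : ProbabilityMeasure (UnitAddTorus d)) (f : C(UnitAddTorus d, ℂ)),
      Integrable f (μ : Measure _) := fun μ f =>
    (BoundedContinuousFunction.mkOfCompact f).integrable _
  have hspan : ∀ f ∈ Submodule.span ℂ (Set.range (UnitAddTorus.mFourier (d := d))),
      Tendsto (fun i => ∫ x, f x ∂(μs i : Measure _)) l (𝓝 (∫ x, f x ∂(ν : Measure _))) := by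
    intro f hf
    induction hf using Submodule.span_induction with
    | mem f hf => obtain ⟨n, rfl⟩ := hf; exact h n
    | zero => simpa using tendsto_const_nhds
    | add f g _ _ hf hg =>
      simp only [ContinuousMap.add_apply]
      simp_rw [integral_add (hint _ f) (hint _ g)]
      exact hf.add hg
    | smul c f _ hf =>
      simp only [ContinuousMap.smul_apply]
      simp_rw [integral_smul]
      exact hf.const_smul c
  have hdist : ∀ (μ : ProbabilityMeasure (UnitAddTorus d)) (f g : C(UnitAddTorus d, ℂ)),
      dist (∫ x, f x ∂(μ : Measure _)) (∫ x, g x ∂(μ : Measure _)) ≤ dist f g := by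
    intro μ f g
    rw [dist_eq_norm, ← integral_sub (hint μ f) (hint μ g)]
    refine (norm_integral_le_of_norm_le_const (C := dist f g) (Eventually.of_forall fun x => ?_)).trans
      (by simp)
    rw [← dist_eq_norm]
    exact ContinuousMap.dist_apply_le_dist x
  rw [ProbabilityMeasure.tendsto_iff_forall_integral_rclike_tendsto ℂ]
  intro f
  rw [Metric.tendsto_nhds]
  intro ε hε
  -- Trigonometric polynomials are uniformly dense, and integration against a probability measure is
  -- 1-Lipschitz in the sup norm.
  have hf : f.toContinuousMap ∈
      closure (Submodule.span ℂ (Set.range (UnitAddTorus.mFourier (d := d))) :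
        Set C(UnitAddTorus d, ℂ)) := by
    rw [← Submodule.topologicalClosure_coe, UnitAddTorus.span_mFourier_closure_eq_top]
    trivial
  obtain ⟨g, hg, hfg⟩ := Metric.mem_closure_iff.1 hf (ε / 3) (by positivity)
  filter_upwards [Metric.tendsto_nhds.1 (hspan g hg) (ε / 3) (by positivity)] with i hi
  have h1 := hdist (μs i) f.toContinuousMap g
  have h2 := hdist ν g f.toContinuousMap
  rw [dist_comm g] at h2
  have h3 := dist_triangle4 (∫ x, f.toContinuousMap x ∂(μs i : Measure _))
    (∫ x, g x ∂(μs i : Measure _)) (∫ x, g x ∂(ν : Measure _))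
    (∫ x, f.toContinuousMap x ∂(ν : Measure _))
  exact lt_of_le_of_lt h3 (by linarith)

/-- The projection from Euclidean space to the torus. -/
def torusMk (d : Type*) (x : d → ℝ) : UnitAddTorus d := fun i => (x i : UnitAddCircle)

theorem continuous_torusMk (d : Type*) : Continuous (torusMk d) :=
  continuous_pi fun i => (AddCircle.continuous_mk' 1).comp (continuous_apply i)

theorem isOpenMap_torusMk (d : Type*) [Finite d] : IsOpenMap (torusMk d) :=
  IsOpenMap.piMap (fun _ => QuotientAddGroup.isOpenMap_coe)
    (by simp)

theorem torusMk_injOn (d : Type*) :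
    Set.InjOn (torusMk d) (Set.univ.pi fun _ => Set.Ico (0 : ℝ) 1) := by
  intro x hx y hy h
  funext i
  have h1 := congrFun h i
  have hx' := hx i trivial
  have hy' := hy i trivial
  simp only [torusMk] at h1
  rw [← zero_add (1 : ℝ)] at hx' hy'
  exact (AddCircle.coe_eq_coe_iff_of_mem_Ico hx' hy').1 h1

open MeasureTheory in
/-- The uniform probability measure on the unit cube. -/
noncomputable def cubeMeasure (d : Type*) [Fintype d] : Measure (d → ℝ) :=
  Measure.pi fun _ => volume.restrict (Set.Ioo (0 : ℝ) 1)

open MeasureTheory in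
theorem isProbabilityMeasure_restrict_Ioo :
    IsProbabilityMeasure (volume.restrict (Set.Ioo (0 : ℝ) 1)) := ⟨by simp⟩

open MeasureTheory in
instance (d : Type*) [Fintype d] : IsProbabilityMeasure (cubeMeasure d) := by
  have := isProbabilityMeasure_restrict_Ioo
  unfold cubeMeasure
  infer_instance

open MeasureTheory in
/-- `cubeMeasure` as a `ProbabilityMeasure`. -/
noncomputable def cubeProbability (d : Type*) [Fintype d] : ProbabilityMeasure (d → ℝ) :=
  ⟨cubeMeasure d, inferInstance⟩

open MeasureTheory in
theorem cubeMeasure_eq_restrict (d : Type*) [Fintype d] :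
    cubeMeasure d = volume.restrict (Set.univ.pi fun _ => Set.Ioo (0 : ℝ) 1) := by
  rw [cubeMeasure, volume_pi, Measure.restrict_pi_pi]

open MeasureTheory in
theorem integral_mFourier_cubeMeasure {d : Type*} [Fintype d] {n : d → ℤ} (hn : n ≠ 0) :
    ∫ x, UnitAddTorus.mFourier n (torusMk d x) ∂cubeMeasure d = 0 := by
  obtain ⟨i, hi⟩ := Function.ne_iff.1 hn
  have h1 := integral_fintype_prod_eq_prod (𝕜 := ℂ) (ι := d) (E := fun _ => ℝ)
    (μ := fun _ => volume.restrict (Set.Ioo (0 : ℝ) 1))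
    (fun i x => fourier (n i) (x : UnitAddCircle))
  refine h1.trans (Finset.prod_eq_zero (Finset.mem_univ i) ?_)
  rw [← integral_Ioc_eq_integral_Ioo, ← intervalIntegral.integral_of_le zero_le_one]
  have h2 : ∀ x : ℝ, (fourier (n i) (x : UnitAddCircle) : ℂ) =
      Complex.exp (2 * Real.pi * Complex.I * n i * x) := by
    intro x; rw [fourier_coe_apply]; simp
  simp_rw [h2]
  have h3 : (2 * Real.pi * Complex.I * n i : ℂ) ≠ 0 := by
    simp only [Pi.zero_apply] at hi
    simp [Real.pi_ne_zero, hi]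
  rw [integral_exp_mul_complex h3]
  simp only [Complex.ofReal_one, mul_one, Complex.ofReal_zero, mul_zero, Complex.exp_zero]
  rw [show (2 * Real.pi * Complex.I * n i : ℂ) = n i * (2 * Real.pi * Complex.I) by ring,
    Complex.exp_int_mul_two_pi_mul_I]
  simp

open MeasureTheory in
/-- Weyl's criterion for measures on the unit cube. -/
theorem tendsto_cubeMeasure {d ι : Type*} [Fintype d] {l : Filter ι} [l.IsCountablyGenerated]
    {μs : ι → ProbabilityMeasure (d → ℝ)}
    (hs : ∀ i, (μs i : Measure (d → ℝ)) (Set.univ.pi fun _ => Set.Ico (0 : ℝ) 1)ᶜ = 0)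
    (h : ∀ n : d → ℤ, n ≠ 0 →
      Tendsto (fun i => ∫ x, UnitAddTorus.mFourier n (torusMk d x) ∂(μs i : Measure _)) l (𝓝 0)) :
    Tendsto μs l (𝓝 (cubeProbability d)) := by
  have hπ : ∀ μ : Measure (d → ℝ), AEMeasurable (torusMk d) μ := fun μ =>
    (continuous_torusMk d).measurable.aemeasurable
  let ν := cubeProbability d
  have hweyl : Tendsto (fun i => (μs i).map (hπ _)) l (𝓝 (ν.map (hπ _))) := by
    refine tendsto_probabilityMeasure_unitAddTorus fun n => ?_
    have hm : ∀ μ : Measure (d → ℝ), ∫ x, UnitAddTorus.mFourier n x ∂(μ.map (torusMk d)) =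
        ∫ x, UnitAddTorus.mFourier n (torusMk d x) ∂μ := fun μ =>
      integral_map (hπ μ) (UnitAddTorus.mFourier n).continuous.aestronglyMeasurable
    refine Tendsto.congr (fun i => (hm (μs i)).symm) ?_
    rw [show ∫ x, UnitAddTorus.mFourier n x ∂(ν.map (hπ _) : Measure _) = _ from hm ν]
    rcases eq_or_ne n 0 with rfl | hn
    · simpa [UnitAddTorus.mFourier_zero] using tendsto_const_nhds
    · have : ∫ x, UnitAddTorus.mFourier n (torusMk d x) ∂(ν : Measure (d → ℝ)) = 0 :=
        integral_mFourier_cubeMeasure hn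
      rw [this]
      exact h n hn
  -- By the portmanteau theorem, lower bounds on open sets suffice. The open cube carries all the
  -- mass of the limit, and `torusMk` is open and injective on the half-open cube, so the bound for
  -- the image of U ∩ I transfers to U.
  refine tendsto_of_forall_isOpen_le_liminf' fun U hU => ?_
  set I : Set (d → ℝ) := Set.univ.pi fun _ => Set.Ioo (0 : ℝ) 1 with hI
  have hIo : IsOpen I := isOpen_set_pi Set.finite_univ fun _ _ => isOpen_Ioo
  set V := torusMk d '' (U ∩ I) with hV
  have hVo : IsOpen V := isOpenMap_torusMk d _ (hU.inter hIo)
  have h1 := ProbabilityMeasure.le_liminf_measure_open_of_tendsto hweyl hVo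
  have h2 : (ν : Measure (d → ℝ)) U ≤ (ν.map (hπ _) : Measure _) V := by
    rw [ProbabilityMeasure.toMeasure_map, Measure.map_apply_of_aemeasurable (hπ _) hVo.measurableSet]
    have : (ν : Measure (d → ℝ)) U = (ν : Measure (d → ℝ)) (U ∩ I) := by
      change cubeMeasure d U = cubeMeasure d (U ∩ I)
      rw [cubeMeasure_eq_restrict, Measure.restrict_apply hU.measurableSet,
        Measure.restrict_apply (hU.inter hIo).measurableSet, Set.inter_assoc, Set.inter_self]
    rw [this]
    exact measure_mono (Set.subset_preimage_image _ _)
  refine h2.trans (h1.trans (liminf_le_liminf (Eventually.of_forall fun i => ?_)))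
  rw [ProbabilityMeasure.toMeasure_map, Measure.map_apply_of_aemeasurable (hπ _) hVo.measurableSet]
  refine (measure_mono (t := U ∪ (Set.univ.pi fun _ => Set.Ico (0 : ℝ) 1)ᶜ) ?_).trans
    ((measure_union_le _ _).trans (by rw [hs i, add_zero]))
  rintro x ⟨y, ⟨hyU, hyI⟩, hyx⟩
  by_cases hx : x ∈ Set.univ.pi fun _ => Set.Ico (0 : ℝ) 1
  · left
    have : y = x := torusMk_injOn d (fun i hi => Set.Ioo_subset_Ico_self (hyI i hi)) hx hyx
    rwa [← this]
  · exact Or.inr hx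

/-! ### Equidistribution of the points (d/b, d̄/b). -/

/-- Pairs `(b, d)` with `0 ≤ d < b ≤ X` and `d` coprime to `b`. -/
def coprimePairs (X : ℕ) : Finset (ℕ × ℕ) :=
  (Finset.Ioc 0 X ×ˢ Finset.range X).filter fun p => p.2 < p.1 ∧ p.1.Coprime p.2

/-- The representative in `{0, …, b - 1}` of the inverse of `d` modulo `b`. -/
def invMod (b d : ℕ) : ℕ := ((d : ZMod b)⁻¹).val

/-- The point `(d / b, d̄ / b)`, where `d̄` is the inverse of `d` modulo `b`. -/
noncomputable def inversePoint (p : ℕ × ℕ) : Fin 2 → ℝ :=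
  ![(p.2 : ℝ) / p.1, (invMod p.1 p.2 : ℝ) / p.1]

theorem mem_coprimePairs {X : ℕ} {p : ℕ × ℕ} :
    p ∈ coprimePairs X ↔ p.1 ≤ X ∧ p.2 < p.1 ∧ p.1.Coprime p.2 := by
  simp only [coprimePairs, Finset.mem_filter, Finset.mem_product, Finset.mem_Ioc, Finset.mem_range]
  omega

theorem sum_coprimePairs {M : Type*} [AddCommMonoid M] (X : ℕ) (f : ℕ × ℕ → M) :
    ∑ p ∈ coprimePairs X, f p =
      ∑ b ∈ Finset.Ioc 0 X, ∑ d ∈ (Finset.range b).filter b.Coprime, f (b, d) := by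
  rw [coprimePairs, Finset.sum_filter, Finset.sum_product]
  refine Finset.sum_congr rfl fun b hb => ?_
  rw [← Finset.sum_filter]
  refine Finset.sum_congr ?_ fun _ _ => rfl
  ext d
  simp only [Finset.mem_Ioc] at hb
  simp only [Finset.mem_filter, Finset.mem_range]
  omega

theorem card_coprimePairs (X : ℕ) :
    ((coprimePairs X).card : ℝ) = ∑ n ∈ Finset.Ioc 0 X, (n.totient : ℝ) := by
  rw [Finset.card_eq_sum_ones, sum_coprimePairs]
  simp [Nat.totient]

theorem inversePoint_mem {X : ℕ} {p : ℕ × ℕ} (hp : p ∈ coprimePairs X) :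
    inversePoint p ∈ Set.univ.pi fun _ => Set.Ico (0 : ℝ) 1 := by
  obtain ⟨-, h1, -⟩ := mem_coprimePairs.1 hp
  have : NeZero p.1 := ⟨by omega⟩
  have h0 : (0 : ℝ) < p.1 := by exact_mod_cast (by omega : 0 < p.1)
  have h2 : invMod p.1 p.2 < p.1 := ZMod.val_lt _
  intro i _
  fin_cases i
  · exact ⟨by simp [inversePoint]; positivity, by
      simp only [inversePoint]
      exact (div_lt_one h0).2 (by exact_mod_cast h1)⟩
  · exact ⟨by simp [inversePoint]; positivity, by
      simp only [inversePoint]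
      exact (div_lt_one h0).2 (by exact_mod_cast h2)⟩

/-- The link between the two subjects: for fixed b, the Weyl sum is a Kloosterman sum, by
identifying residues prime to b with the units of `ZMod b`. -/
theorem sum_mFourier_inversePoint (n : Fin 2 → ℤ) (b : ℕ) :
    ∑ d ∈ (Finset.range b).filter b.Coprime,
      UnitAddTorus.mFourier n (torusMk _ (inversePoint (b, d))) =
      zmodKloosterman (n 0) (n 1) b := by
  rcases eq_or_ne b 0 with rfl | hb
  · simp [zmodKloosterman]
  have : NeZero b := ⟨hb⟩
  rw [zmodKloosterman_of_neZero, kloostermanSum]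
  symm
  refine Finset.sum_nbij (fun u : (ZMod b)ˣ => (u : ZMod b).val) ?_ ?_ ?_ ?_
  · intro u _
    simp only [Finset.mem_filter, Finset.mem_range]
    exact ⟨ZMod.val_lt _, (ZMod.val_coe_unit_coprime u).symm⟩
  · intro u _ v _ h
    exact Units.ext (ZMod.val_injective b h)
  · intro d hd
    simp only [Finset.coe_filter, Finset.mem_range, Set.mem_ofPred_eq] at hd
    refine ⟨ZMod.unitOfCoprime d hd.2.symm, by simp, ?_⟩
    simp [ZMod.val_cast_of_lt hd.1]
  · intro u _
    have h : (n 0 : ZMod b) * u + (n 1 : ZMod b) * (u⁻¹ : (ZMod b)ˣ) =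
        ((n 0 * ((u : ZMod b).val : ℤ) + n 1 * (invMod b (u : ZMod b).val : ℤ) : ℤ) : ZMod b) := by
      push_cast
      simp [invMod]
    rw [h, ZMod.stdAddChar_coe]
    simp only [UnitAddTorus.mFourier, ContinuousMap.coe_mk, Fin.prod_univ_two, torusMk,
      fourier_coe_apply, inversePoint]
    rw [← Complex.exp_add]
    congr 1
    simp [-ZMod.natCast_val]
    field_simp

open MeasureTheory in
/-- The normalized counting measure on the points attached to `coprimePairs X`. -/
noncomputable def empiricalMeasure (X : ℕ) : Measure (Fin 2 → ℝ) :=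
  ((coprimePairs X).card : ENNReal)⁻¹ • ∑ p ∈ coprimePairs X, Measure.dirac (inversePoint p)

/-- `coprimePairs 0` is empty, so the probability measures are indexed with the shift X + 1. -/
theorem coprimePairs_nonempty (X : ℕ) : (coprimePairs (X + 1)).Nonempty :=
  ⟨(1, 0), mem_coprimePairs.2 (by simp)⟩

open Classical in
theorem empiricalMeasure_apply (X : ℕ) {U : Set (Fin 2 → ℝ)} (hU : MeasurableSet U) :
    empiricalMeasure X U = ((coprimePairs X).card : ENNReal)⁻¹ *
      ((coprimePairs X).filter fun p => inversePoint p ∈ U).card := by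
  rw [empiricalMeasure, MeasureTheory.Measure.smul_apply, MeasureTheory.Measure.finsetSum_apply,
    smul_eq_mul, Finset.card_filter]
  congr 1
  push_cast
  refine Finset.sum_congr rfl fun p _ => ?_
  rw [MeasureTheory.Measure.dirac_apply' _ hU]
  simp [Set.indicator_apply]

theorem empiricalMeasure_eq_zero {X : ℕ} {U : Set (Fin 2 → ℝ)} (hU : MeasurableSet U)
    (h : ∀ p ∈ coprimePairs X, inversePoint p ∉ U) : empiricalMeasure X U = 0 := by
  classical
  rw [empiricalMeasure_apply X hU, Finset.filter_false_of_mem h]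
  simp

open MeasureTheory in
instance (X : ℕ) : IsProbabilityMeasure (empiricalMeasure (X + 1)) := by
  refine ⟨?_⟩
  classical
  rw [empiricalMeasure_apply _ MeasurableSet.univ]
  simp only [Set.mem_univ, Finset.filter_true]
  exact ENNReal.inv_mul_cancel (by simpa using (coprimePairs_nonempty X).ne_empty) (by simp)

open MeasureTheory in
/-- `empiricalMeasure` as a `ProbabilityMeasure`. -/
noncomputable def empiricalProbability (X : ℕ) : ProbabilityMeasure (Fin 2 → ℝ) :=
  ⟨empiricalMeasure (X + 1), inferInstance⟩

open MeasureTheory in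
theorem integral_empiricalMeasure (X : ℕ) {f : (Fin 2 → ℝ) → ℂ} :
    ∫ x, f x ∂empiricalMeasure X =
      ((coprimePairs X).card : ℝ)⁻¹ • ∑ p ∈ coprimePairs X, f (inversePoint p) := by
  rw [empiricalMeasure, integral_smul_measure,
    integral_finsetSum_measure fun p _ => integrable_dirac (by finiteness)]
  simp

theorem tendsto_card_coprimePairs_div_sq :
    Tendsto (fun X : ℕ => ((coprimePairs X).card : ℝ) / (X : ℝ) ^ 2) atTop (𝓝 totientConst) := by
  simp_rw [card_coprimePairs]
  exact tendsto_sum_totient_div_sq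

open MeasureTheory in
/-- The points `(d / b, d̄ / b)` become equidistributed in the unit square. -/
theorem tendsto_empiricalMeasure :
    Tendsto empiricalProbability atTop (𝓝 (cubeProbability (Fin 2))) := by
  refine tendsto_cubeMeasure (fun X => ?_) fun n hn => ?_
  · change empiricalMeasure (X + 1) _ = 0
    exact empiricalMeasure_eq_zero (MeasurableSet.univ_pi fun _ => measurableSet_Ico).compl
      fun p hp h => h (inversePoint_mem hp)
  · have hmn : n 0 ≠ 0 ∨ n 1 ≠ 0 := by
      by_contra! h
      exact hn (by ext i; fin_cases i <;> simp [h])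
    have h1 := ((tendsto_sum_norm_zmodKloosterman hmn).div tendsto_card_coprimePairs_div_sq
      totientConst_ne_zero).comp (tendsto_add_atTop_nat 1)
    rw [zero_div] at h1
    refine squeeze_zero_norm (fun X => ?_) h1
    change ‖∫ x, UnitAddTorus.mFourier n (torusMk _ x) ∂empiricalMeasure (X + 1)‖ ≤ _
    rw [integral_empiricalMeasure, sum_coprimePairs]
    simp_rw [sum_mFourier_inversePoint]
    have hX : (((X + 1 : ℕ) : ℝ) ^ 2) ≠ 0 := by positivity
    simp only [Function.comp_apply, Pi.div_apply]
    rw [div_div_div_cancel_right₀ hX, norm_smul, norm_inv, Real.norm_natCast, div_eq_inv_mul]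
    gcongr
    exact norm_sum_le _ _

open Classical MeasureTheory in
theorem tendsto_card_filter_inversePoint_mem {U : Set (Fin 2 → ℝ)} (hm : MeasurableSet U)
    (hU : volume (frontier U) = 0) :
    Tendsto (fun X : ℕ => (((coprimePairs X).filter fun p => inversePoint p ∈ U).card : ℝ) /
      (X : ℝ) ^ 2) atTop (𝓝 (totientConst * (cubeMeasure (Fin 2)).real U)) := by
  have h0 : cubeMeasure (Fin 2) (frontier U) = 0 := by
    rw [cubeMeasure_eq_restrict]
    exact Measure.restrict_le_self.absolutelyContinuous hU
  have h1 := ProbabilityMeasure.tendsto_measure_of_null_frontier_of_tendsto'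
    tendsto_empiricalMeasure h0
  have h2 := (ENNReal.tendsto_toReal (measure_ne_top (cubeMeasure (Fin 2)) U)).comp h1
  rw [← tendsto_add_atTop_iff_nat 1]
  refine ((tendsto_card_coprimePairs_div_sq.comp (tendsto_add_atTop_nat 1)).mul h2).congr
    fun X => ?_
  have h3 : (empiricalProbability X : Measure (Fin 2 → ℝ)) U = _ := empiricalMeasure_apply (X + 1) hm
  have h4 : ((coprimePairs (X + 1)).card : ℝ) ≠ 0 := by
    exact_mod_cast (Finset.card_pos.2 (coprimePairs_nonempty X)).ne'
  simp only [Function.comp_apply]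
  rw [h3, ENNReal.toReal_mul, ENNReal.toReal_inv, ENNReal.toReal_natCast, ENNReal.toReal_natCast]
  field_simp

open Classical MeasureTheory in
theorem tendsto_card_filter_floor_inversePoint_mem {U : Set (Fin 2 → ℝ)} (hm : MeasurableSet U)
    (hU : volume (frontier U) = 0) {c : ℝ} (hc : 0 < c) :
    Tendsto (fun Q : ℕ => (((coprimePairs ⌊(Q : ℝ) / c⌋₊).filter
      fun p => inversePoint p ∈ U).card : ℝ) / (Q : ℝ) ^ 2) atTop
      (𝓝 (totientConst * ((cubeMeasure (Fin 2)).real U / c ^ 2))) := by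
  have hfl : Tendsto (fun Q : ℕ => ⌊(Q : ℝ) / c⌋₊) atTop atTop :=
    tendsto_nat_floor_atTop.comp (tendsto_natCast_atTop_atTop.atTop_div_const hc)
  have h1 := (tendsto_card_filter_inversePoint_mem hm hU).comp hfl
  have h2 : Tendsto (fun Q : ℕ => (⌊(Q : ℝ) / c⌋₊ : ℝ) / Q) atTop (𝓝 (1 / c)) := by
    refine ((tendsto_nat_floor_mul_div_atTop (R := ℝ) (a := 1 / c) (by positivity)).comp
      tendsto_natCast_atTop_atTop).congr fun Q => ?_
    simp only [Function.comp_apply, one_div_mul_eq_div]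
  have h3 := h1.mul (h2.pow 2)
  have hl : totientConst * (cubeMeasure (Fin 2)).real U * (1 / c) ^ 2 =
      totientConst * ((cubeMeasure (Fin 2)).real U / c ^ 2) := by field_simp
  rw [hl] at h3
  refine h3.congr' ?_
  filter_upwards [hfl.eventually_gt_atTop 0] with Q hQ
  have : (⌊(Q : ℝ) / c⌋₊ : ℝ) ≠ 0 := by exact_mod_cast hQ.ne'
  simp only [Function.comp_apply]
  field_simp

/-! ### From equidistribution to the count with b(1 + x + y) ≤ Q. -/

/-- The slice `x₀ ≤ β`, `s ≤ 1 + x₀ + x₁ < t` of the plane. -/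
def planeSlice (β s t : ℝ) : Set (Fin 2 → ℝ) :=
  {x | x 0 ≤ β ∧ s ≤ 1 + x 0 + x 1 ∧ 1 + x 0 + x 1 < t}

theorem convex_planeSlice (β s t : ℝ) : Convex ℝ (planeSlice β s t) := by
  rintro x ⟨h1, h2, h3⟩ y ⟨h4, h5, h6⟩ a b ha hb hab
  simp only [planeSlice, Set.mem_ofPred_eq, Pi.add_apply, Pi.smul_apply, smul_eq_mul]
  obtain rfl : b = 1 - a := by linarith
  refine ⟨by nlinarith, by nlinarith, ?_⟩
  rcases ha.eq_or_lt with rfl | ha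
  · linarith
  · nlinarith [mul_lt_mul_of_pos_left h3 ha, mul_le_mul_of_nonneg_left h6.le hb]

theorem measurableSet_planeSlice (β s t : ℝ) : MeasurableSet (planeSlice β s t) := by
  have h0 : Measurable fun x : Fin 2 → ℝ => x 0 := measurable_pi_apply 0
  have h1 : Measurable fun x : Fin 2 → ℝ => 1 + x 0 + x 1 := by fun_prop
  exact (measurableSet_le h0 measurable_const).inter
    ((measurableSet_le measurable_const h1).inter (measurableSet_lt h1 measurable_const))

theorem volume_frontier_planeSlice (β s t : ℝ) :
    MeasureTheory.volume (frontier (planeSlice β s t)) = 0 :=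
  (convex_planeSlice β s t).addHaar_frontier _

theorem disjoint_planeSlice (β c : ℝ) (hc : 1 ≤ c) {i j : ℕ} (hij : i ≠ j) :
    Disjoint (planeSlice β (c ^ i) (c ^ (i + 1))) (planeSlice β (c ^ j) (c ^ (j + 1))) := by
  have key : ∀ i j : ℕ, i < j →
      Disjoint (planeSlice β (c ^ i) (c ^ (i + 1))) (planeSlice β (c ^ j) (c ^ (j + 1))) := by
    intro i j hij
    refine Set.disjoint_left.2 fun x hx hy => ?_
    have := pow_le_pow_right₀ hc (Nat.succ_le_of_lt hij)
    exact absurd (hx.2.2.trans_le this) (not_lt.2 hy.2.1)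
  rcases lt_or_gt_of_ne hij with h | h
  · exact key i j h
  · exact (key j i h).symm

theorem exists_mem_planeSlice {β c : ℝ} (hc : 1 < c) {J : ℕ} (hJ : 3 < c ^ J) {x : Fin 2 → ℝ}
    (hx : x ∈ Set.univ.pi fun _ => Set.Ico (0 : ℝ) 1) (hβ : x 0 ≤ β) :
    ∃ j ∈ Finset.range J, x ∈ planeSlice β (c ^ j) (c ^ (j + 1)) := by
  have h0 := hx 0 trivial
  have h1 := hx 1 trivial
  simp only [Set.mem_Ico] at h0 h1
  -- On the unit square 1 ≤ 1 + x₀ + x₁ < 3 < c ^ J, so only the exponents j < J occur.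
  obtain ⟨j, h2, h3⟩ := exists_nat_pow_near (x := 1 + x 0 + x 1) (by linarith) hc
  refine ⟨j, Finset.mem_range.2 ?_, hβ, h2, h3⟩
  by_contra! h
  have := pow_le_pow_right₀ hc.le h
  linarith

/-- The number of coprime pairs `d < b` with `d / b ≤ β` and `b + d + d̄ ≤ Q`. -/
noncomputable def hyperbolicCount (β : ℝ) (Q : ℕ) : ℕ :=
  open Classical in ((coprimePairs Q).filter fun p => inversePoint p 0 ≤ β ∧
    (p.1 : ℝ) * (1 + inversePoint p 0 + inversePoint p 1) ≤ Q).card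

-- On the j-th slice the factor 1 + x + y is at least c ^ j, so the trace condition forces b ≤ Q/c ^
-- j.
open Classical in
theorem hyperbolicCount_le (β : ℝ) (Q : ℕ) {c : ℝ} (hc : 1 < c) {J : ℕ} (hJ : 3 < c ^ J) :
    hyperbolicCount β Q ≤ ∑ j ∈ Finset.range J,
      ((coprimePairs ⌊(Q : ℝ) / c ^ j⌋₊).filter fun p =>
        inversePoint p ∈ planeSlice β (c ^ j) (c ^ (j + 1))).card := by
  refine (Finset.card_le_card ?_).trans Finset.card_biUnion_le
  intro p hp
  simp only [Finset.mem_filter] at hp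
  obtain ⟨hp, hβ, hQ⟩ := hp
  obtain ⟨j, hj, hs⟩ := exists_mem_planeSlice hc hJ (inversePoint_mem hp) hβ
  simp only [Finset.mem_biUnion, Finset.mem_filter]
  refine ⟨j, hj, mem_coprimePairs.2 ⟨Nat.le_floor ?_, (mem_coprimePairs.1 hp).2⟩, hs⟩
  rw [le_div_iff₀ (by positivity)]
  exact (mul_le_mul_of_nonneg_left hs.2.1 (Nat.cast_nonneg _)).trans hQ

-- On the j-th slice the factor is below c ^ (j + 1), so b ≤ Q/c ^ (j + 1) already implies the trace
-- condition.
open Classical in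
theorem le_hyperbolicCount (β : ℝ) (Q : ℕ) {c : ℝ} (hc : 1 < c) (J : ℕ) :
    ∑ j ∈ Finset.range J, ((coprimePairs ⌊(Q : ℝ) / c ^ (j + 1)⌋₊).filter fun p =>
        inversePoint p ∈ planeSlice β (c ^ j) (c ^ (j + 1))).card ≤ hyperbolicCount β Q := by
  rw [← Finset.card_biUnion]
  · refine Finset.card_le_card fun p hp => ?_
    simp only [Finset.mem_biUnion, Finset.mem_filter] at hp
    obtain ⟨j, -, hp, hs⟩ := hp
    obtain ⟨h1, h2⟩ := mem_coprimePairs.1 hp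
    have h3 : (p.1 : ℝ) ≤ Q / c ^ (j + 1) :=
      (Nat.cast_le.2 h1).trans (Nat.floor_le (by positivity))
    have hcj : 1 ≤ c ^ (j + 1) := one_le_pow₀ hc.le
    have h4 : (p.1 : ℝ) * c ^ (j + 1) ≤ Q := by rwa [le_div_iff₀ (by positivity)] at h3
    simp only [Finset.mem_filter]
    refine ⟨mem_coprimePairs.2 ⟨?_, h2⟩, hs.1,
      (mul_le_mul_of_nonneg_left hs.2.2.le (Nat.cast_nonneg _)).trans h4⟩
    have : (p.1 : ℝ) ≤ Q := (le_mul_of_one_le_right (Nat.cast_nonneg _) hcj).trans h4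
    exact_mod_cast this
  · intro i _ j _ hij
    refine Finset.disjoint_left.2 fun p hp hq => ?_
    simp only [Finset.mem_filter] at hp hq
    exact Set.disjoint_left.1 (disjoint_planeSlice β c hc.le hij) hp.2 hq.2

open MeasureTheory in
theorem ae_cubeMeasure_mem {d : Type*} [Fintype d] :
    ∀ᵐ x ∂cubeMeasure d, x ∈ Set.univ.pi fun _ => Set.Ioo (0 : ℝ) 1 := by
  rw [cubeMeasure_eq_restrict]
  exact ae_restrict_mem (MeasurableSet.univ_pi fun _ => measurableSet_Ioo)

open MeasureTheory in
theorem integrable_inv_sq_cubeMeasure :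
    Integrable (fun x : Fin 2 → ℝ => ((1 + x 0 + x 1) ^ 2)⁻¹) (cubeMeasure (Fin 2)) := by
  refine Integrable.of_bound (Measurable.aestronglyMeasurable (by fun_prop)) 1 ?_
  filter_upwards [ae_cubeMeasure_mem] with x hx
  have h0 := (hx 0 trivial).1
  have h1 := (hx 1 trivial).1
  rw [Real.norm_of_nonneg (by positivity)]
  exact inv_le_one_of_one_le₀ (one_le_pow₀ (by linarith))

/-- The integral of `(1 + x + y)⁻²` over the part `x ≤ β` of the unit square. -/
noncomputable def sliceIntegral (β : ℝ) : ℝ :=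
  ∫ x in {x : Fin 2 → ℝ | x 0 ≤ β}, ((1 + x 0 + x 1) ^ 2)⁻¹ ∂cubeMeasure (Fin 2)

open MeasureTheory in
theorem sliceIntegral_eq_sum (β : ℝ) {c : ℝ} (hc : 1 < c) {J : ℕ} (hJ : 3 < c ^ J) :
    sliceIntegral β = ∑ j ∈ Finset.range J,
      ∫ x in planeSlice β (c ^ j) (c ^ (j + 1)), ((1 + x 0 + x 1) ^ 2)⁻¹ ∂cubeMeasure (Fin 2) := by
  rw [sliceIntegral, ← integral_biUnion_finset _ (fun _ _ => measurableSet_planeSlice _ _ _)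
    (fun i _ j _ hij => disjoint_planeSlice β c hc.le hij)
    (fun _ _ => integrable_inv_sq_cubeMeasure.integrableOn)]
  refine setIntegral_congr_set ?_
  filter_upwards [ae_cubeMeasure_mem] with x hx
  refine propext ⟨fun h => ?_, fun h => ?_⟩
  · obtain ⟨j, hj, hs⟩ := exists_mem_planeSlice hc hJ
      (fun i hi => Set.Ioo_subset_Ico_self (hx i hi)) h
    exact Set.mem_biUnion hj hs
  · obtain ⟨j, -, hs⟩ := Set.mem_iUnion₂.1 h
    exact hs.1

open MeasureTheory in
theorem setIntegral_planeSlice_le (β : ℝ) {s t : ℝ} (hs : 0 < s) :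
    ∫ x in planeSlice β s t, ((1 + x 0 + x 1) ^ 2)⁻¹ ∂cubeMeasure (Fin 2) ≤
      (cubeMeasure (Fin 2)).real (planeSlice β s t) / s ^ 2 := by
  refine (setIntegral_mono_on integrable_inv_sq_cubeMeasure.integrableOn
    (integrable_const (s ^ 2)⁻¹) (measurableSet_planeSlice β s t) fun x hx => ?_).trans_eq ?_
  · have := hx.2.1
    gcongr
  · simp [div_eq_mul_inv]

open MeasureTheory in
theorem le_setIntegral_planeSlice (β : ℝ) {s t : ℝ} (hs : 0 < s) :
    (cubeMeasure (Fin 2)).real (planeSlice β s t) / t ^ 2 ≤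
      ∫ x in planeSlice β s t, ((1 + x 0 + x 1) ^ 2)⁻¹ ∂cubeMeasure (Fin 2) := by
  refine Eq.trans_le ?_ (setIntegral_mono_on (integrable_const (t ^ 2)⁻¹)
    integrable_inv_sq_cubeMeasure.integrableOn (measurableSet_planeSlice β s t) fun x hx => ?_)
  · simp [div_eq_mul_inv]
  · have := hx.2.1
    have := hx.2.2.le
    have : 0 < 1 + x 0 + x 1 := by linarith
    gcongr

/-- For fixed c > 1 there are finitely many slices, each with a known limit. The upper and lower
sums lie within a factor c² of the integral, and c is then taken close to 1. -/
theorem tendsto_hyperbolicCount (β : ℝ) :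
    Tendsto (fun Q : ℕ => (hyperbolicCount β Q : ℝ) / (Q : ℝ) ^ 2) atTop
      (𝓝 (totientConst * sliceIntegral β)) := by
  classical
  have hC := totientConst_pos
  have hcont : Tendsto (fun c : ℝ => totientConst * (c ^ 2 * sliceIntegral β)) (𝓝[>] 1)
      (𝓝 (totientConst * sliceIntegral β)) := by
    have : Continuous fun c : ℝ => totientConst * (c ^ 2 * sliceIntegral β) := by fun_prop
    simpa using (this.tendsto 1).mono_left nhdsWithin_le_nhds
  have hcont' : Tendsto (fun c : ℝ => totientConst * (sliceIntegral β / c ^ 2)) (𝓝[>] 1)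
      (𝓝 (totientConst * sliceIntegral β)) := by
    have : ContinuousAt (fun c : ℝ => totientConst * (sliceIntegral β / c ^ 2)) 1 := by
      fun_prop (disch := norm_num)
    simpa using this.tendsto.mono_left nhdsWithin_le_nhds
  refine tendsto_order.2 ⟨fun a ha => ?_, fun a ha => ?_⟩
  · obtain ⟨c, hca, hc⟩ := ((hcont'.eventually (lt_mem_nhds ha)).and self_mem_nhdsWithin).exists
    have hc : 1 < c := hc
    obtain ⟨J, hJ⟩ := pow_unbounded_of_one_lt (3 : ℝ) hc
    have hlim := tendsto_finsetSum (Finset.range J) fun j _ =>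
      tendsto_card_filter_floor_inversePoint_mem
        (measurableSet_planeSlice β (c ^ j) (c ^ (j + 1)))
        (volume_frontier_planeSlice β (c ^ j) (c ^ (j + 1)))
        (c := c ^ (j + 1)) (by positivity)
    have hlt : a < ∑ j ∈ Finset.range J, totientConst *
        ((cubeMeasure (Fin 2)).real (planeSlice β (c ^ j) (c ^ (j + 1))) / (c ^ (j + 1)) ^ 2) := by
      refine hca.trans_le ?_
      rw [← Finset.mul_sum, sliceIntegral_eq_sum β hc hJ, Finset.sum_div]
      refine mul_le_mul_of_nonneg_left (Finset.sum_le_sum fun j _ => ?_) hC.le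
      refine (div_le_div_of_nonneg_right (setIntegral_planeSlice_le β (by positivity))
        (by positivity)).trans_eq ?_
      rw [div_div, pow_succ c j, mul_pow]
    filter_upwards [hlim.eventually (lt_mem_nhds hlt)] with Q hQ
    refine hQ.trans_le ?_
    rw [← Finset.sum_div]
    gcongr
    exact_mod_cast le_hyperbolicCount β Q hc J
  · obtain ⟨c, hca, hc⟩ := ((hcont.eventually (gt_mem_nhds ha)).and self_mem_nhdsWithin).exists
    have hc : 1 < c := hc
    obtain ⟨J, hJ⟩ := pow_unbounded_of_one_lt (3 : ℝ) hc
    have hlim := tendsto_finsetSum (Finset.range J) fun j _ =>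
      tendsto_card_filter_floor_inversePoint_mem
        (measurableSet_planeSlice β (c ^ j) (c ^ (j + 1)))
        (volume_frontier_planeSlice β (c ^ j) (c ^ (j + 1)))
        (c := c ^ j) (by positivity)
    have hlt : ∑ j ∈ Finset.range J, totientConst *
        ((cubeMeasure (Fin 2)).real (planeSlice β (c ^ j) (c ^ (j + 1))) / (c ^ j) ^ 2) < a := by
      refine lt_of_le_of_lt ?_ hca
      rw [sliceIntegral_eq_sum β hc hJ, Finset.mul_sum, ← Finset.mul_sum]
      refine mul_le_mul_of_nonneg_left (Finset.sum_le_sum fun j _ => ?_) hC.le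
      refine Eq.trans_le ?_ (mul_le_mul_of_nonneg_left
        (le_setIntegral_planeSlice β (by positivity)) (by positivity))
      rw [pow_succ c j]
      field_simp
    filter_upwards [hlim.eventually (gt_mem_nhds hlt)] with Q hQ
    refine lt_of_le_of_lt ?_ hQ
    rw [← Finset.sum_div]
    gcongr
    exact_mod_cast hyperbolicCount_le β Q hc hJ

/-! ### Evaluation of the limiting integral. -/

open MeasureTheory in
theorem sliceIntegral_eq {β : ℝ} (hβ : β ∈ Set.Icc (0 : ℝ) 1) :
    sliceIntegral β = ∫ x in (0 : ℝ)..β, (1 / (1 + x) - 1 / (2 + x)) := by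
  have hp := isProbabilityMeasure_restrict_Ioo
  set μ : Measure ℝ := volume.restrict (Set.Ioo (0 : ℝ) 1) with hμ
  have hmp : MeasurePreserving (MeasurableEquiv.finTwoArrow (α := ℝ)) (cubeMeasure (Fin 2))
      (μ.prod μ) := measurePreserving_finTwoArrow μ
  have h1 : sliceIntegral β =
      ∫ z in {x : ℝ × ℝ | x.1 ≤ β}, ((1 + z.1 + z.2) ^ 2)⁻¹ ∂μ.prod μ :=
    (hmp.setIntegral_preimage_emb (MeasurableEquiv.measurableEmbedding _)
      (fun z : ℝ × ℝ => ((1 + z.1 + z.2) ^ 2)⁻¹) {x : ℝ × ℝ | x.1 ≤ β})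
  have h2 : Integrable (fun z : ℝ × ℝ => ((1 + z.1 + z.2) ^ 2)⁻¹) (μ.prod μ) :=
    (hmp.integrable_comp_emb (MeasurableEquiv.measurableEmbedding _)).1
      integrable_inv_sq_cubeMeasure
  have hset : {x : ℝ × ℝ | x.1 ≤ β} = Set.Iic β ×ˢ Set.univ := by ext; simp
  rw [h1, hset, setIntegral_prod _ h2.integrableOn, hμ, Measure.restrict_restrict measurableSet_Iic]
  have h3 : ∀ x ∈ Set.Iic β ∩ Set.Ioo 0 1,
      ∫ y in Set.univ, ((1 + x + y) ^ 2)⁻¹ ∂(volume.restrict (Set.Ioo (0 : ℝ) 1)) =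
        1 / (1 + x) - 1 / (2 + x) := by
    intro x hx
    have hx0 : 0 < x := hx.2.1
    rw [Measure.restrict_univ, ← integral_Ioc_eq_integral_Ioo,
      ← intervalIntegral.integral_of_le zero_le_one]
    have hd : ∀ y ∈ Set.uIcc (0 : ℝ) 1,
        HasDerivAt (fun y => -(1 + x + y)⁻¹) (((1 + x + y) ^ 2)⁻¹) y := by
      intro y hy
      rw [Set.uIcc_of_le zero_le_one] at hy
      have : 1 + x + y ≠ 0 := by have := hy.1; positivity
      have h := (((hasDerivAt_id y).const_add (1 + x)).inv this).neg
      have e : -(-1 / (1 + x + id y) ^ 2) = ((1 + x + y) ^ 2)⁻¹ := by simp [neg_div]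
      rw [e] at h
      exact h
    rw [intervalIntegral.integral_eq_sub_of_hasDerivAt hd]
    · ring
    · refine ContinuousOn.intervalIntegrable ?_
      rw [Set.uIcc_of_le zero_le_one]
      refine ContinuousOn.inv₀ (by fun_prop) fun y hy => ?_
      have := hy.1
      positivity
  rw [setIntegral_congr_fun (measurableSet_Iic.inter measurableSet_Ioo) h3,
    intervalIntegral.integral_of_le hβ.1]
  refine setIntegral_congr_set ?_
  -- For β = 1 the two domains of integration differ at the endpoint 1.
  have hne : ∀ᵐ x : ℝ, x ≠ 1 := by simp [ae_iff]
  filter_upwards [hne] with x hx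
  refine propext ⟨fun h => ⟨h.2.1, h.1⟩, fun h => ⟨h.2, h.1, lt_of_le_of_ne (h.2.trans hβ.2) hx⟩⟩

theorem sliceIntegral_one : sliceIntegral 1 = Real.log (4 / 3) := by
  rw [sliceIntegral_eq (by simp)]
  have h1 : ∀ a : ℝ, 0 < a → ∫ x in (0 : ℝ)..1, 1 / (a + x) = Real.log ((a + 1) / a) := by
    intro a ha
    rw [intervalIntegral.integral_comp_add_left (fun x => 1 / x), integral_one_div_of_pos]
    · simp
    · linarith
    · linarith
  have h2 : ∀ a : ℝ, 0 < a →
      IntervalIntegrable (fun x => 1 / (a + x)) MeasureTheory.volume 0 1 := by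
    intro a ha
    refine ContinuousOn.intervalIntegrable ?_
    rw [Set.uIcc_of_le zero_le_one]
    refine ContinuousOn.div (by fun_prop) (by fun_prop) fun y hy => ?_
    have := hy.1
    positivity
  rw [intervalIntegral.integral_sub (h2 1 one_pos) (h2 2 two_pos), h1 1 one_pos, h1 2 two_pos,
    ← Real.log_div (by norm_num) (by norm_num)]
  norm_num

/-! ### Saturated Farey fractions as coprime pairs. -/

theorem mul_one_add_inversePoint {X : ℕ} {p : ℕ × ℕ} (hp : p ∈ coprimePairs X) :
    (p.1 : ℝ) * (1 + inversePoint p 0 + inversePoint p 1) =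
      ((p.1 + p.2 + invMod p.1 p.2 : ℕ) : ℝ) := by
  have h : (p.1 : ℝ) ≠ 0 := by
    have := (mem_coprimePairs.1 hp).2.1
    exact_mod_cast (by omega : p.1 ≠ 0)
  simp only [inversePoint, Matrix.cons_val_zero, Matrix.cons_val_one]
  push_cast
  field_simp

theorem invMod_eq_emod {a b d : ℕ} {c : ℤ} (hb : 0 < b) (h : (a : ℤ) * d - b * c = 1) :
    invMod b d = a % b := by
  have : NeZero b := ⟨hb.ne'⟩
  have h1 : (d : ZMod b) * (a : ZMod b) = 1 := by
    have := congrArg (Int.cast : ℤ → ZMod b) h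
    push_cast at this
    rw [ZMod.natCast_self, zero_mul, sub_zero] at this
    rw [mul_comm]; exact this
  rw [invMod, ZMod.inv_eq_of_mul_eq_one b _ _ h1, ZMod.val_natCast]

theorem eq_one_or_exists_of_mem_saturatedFarey {Q : ℕ} {x : ℚ} (hx : x ∈ saturatedFarey Q) :
    x = 1 ∨ ∃ p ∈ coprimePairs Q, p.1 + p.2 + invMod p.1 p.2 ≤ Q ∧ x = (p.2 : ℚ) / p.1 := by
  obtain ⟨M, ⟨⟨h1, h2, h3, h4, h5⟩, ht⟩, rfl⟩ := hx
  rw [Matrix.trace_fin_two] at ht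
  have hdet := M.2
  rw [Matrix.det_fin_two] at hdet
  unfold fracPsi
  generalize M.1 0 0 = a at *
  generalize M.1 0 1 = b at *
  generalize M.1 1 0 = c at *
  generalize M.1 1 1 = d at *
  rcases h2.lt_or_eq with hlt | heq
  · right
    lift a to ℕ using by omega
    lift b to ℕ using by omega
    lift d to ℕ using by omega
    have hmod := invMod_eq_emod (by omega) hdet
    have hcop : b.Coprime d := by
      rw [← Nat.isCoprime_iff_coprime]
      exact ⟨-c, a, by linarith⟩
    -- As a ≥ b, the quotient a / b is at least 1; the least admissible a is therefore b + d̄.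
    have hle : a % b + b ≤ a := by
      have : b ≤ a := by exact_mod_cast h1
      have h6 : 1 ≤ a / b := (Nat.one_le_div_iff (by omega)).2 this
      have := Nat.mod_add_div a b
      nlinarith
    refine ⟨(b, d), mem_coprimePairs.2 ⟨?_, by exact_mod_cast hlt, hcop⟩, ?_, ?_⟩
    · dsimp only; omega
    · dsimp only; rw [hmod]; omega
    · simp
  · left
    rw [heq]
    exact div_self (by exact_mod_cast (by omega : b ≠ 0))

/-- The witness takes a = b + d̄, with c determined by the determinant. The condition b ≥ 2 excludes
the pair (1, 0), for which d = 0. -/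
theorem mem_saturatedFarey {Q : ℕ} {p : ℕ × ℕ} (hp : p ∈ coprimePairs Q) (hp2 : 2 ≤ p.1)
    (hQ : p.1 + p.2 + invMod p.1 p.2 ≤ Q) : (p.2 : ℚ) / p.1 ∈ saturatedFarey Q := by
  obtain ⟨b, d⟩ := p
  obtain ⟨-, hdb, hcop⟩ := mem_coprimePairs.1 hp
  dsimp only at hp2 hQ hdb hcop ⊢
  have : NeZero b := ⟨by omega⟩
  have hd : 1 ≤ d := by
    by_contra! h
    obtain rfl : d = 0 := by omega
    rw [Nat.coprime_zero_right] at hcop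
    omega
  set y := invMod b d with hy
  have hyd : ((b : ℤ)) ∣ ((b : ℤ) + y) * d - 1 := by
    rw [← ZMod.intCast_zmod_eq_zero_iff_dvd]
    push_cast
    rw [hy, invMod, ZMod.natCast_zmod_val, ZMod.natCast_self, zero_add, mul_comm,
      ZMod.coe_mul_inv_eq_one d hcop.symm, sub_self]
  have hy1 : 1 ≤ y := by
    by_contra! h
    obtain h0 : y = 0 := by omega
    rw [h0, Nat.cast_zero, add_zero, dvd_sub_right (dvd_mul_right _ _)] at hyd
    have := Int.le_of_dvd one_pos hyd
    omega
  obtain ⟨c, hc⟩ := hyd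
  have hb0 : (0 : ℤ) < b := by omega
  have hyd1 : (1 : ℤ) ≤ y * d := by exact_mod_cast Nat.mul_le_mul hy1 hd
  refine ⟨⟨!![(b : ℤ) + y, b; c, d], by rw [Matrix.det_fin_two_of]; linarith⟩,
    ⟨⟨?_, ?_, ?_, ?_, ?_⟩, ?_⟩, ?_⟩
  · simp
  · simpa using hdb.le
  · simpa using hd
  · change c ≤ (b : ℤ) + y
    refine le_of_mul_le_mul_left ?_ hb0
    rw [← hc]
    have : (d : ℤ) ≤ b := by exact_mod_cast hdb.le
    nlinarith
  · change (d : ℤ) ≤ c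
    refine le_of_mul_le_mul_left ?_ hb0
    rw [← hc]
    linarith
  · rw [Matrix.trace_fin_two]
    change (b : ℤ) + y + d ≤ Q
    omega
  · simp [fracPsi]

theorem coprimePairs_frac_injOn (Q : ℕ) :
    Set.InjOn (fun p : ℕ × ℕ => (p.2 : ℚ) / p.1) (coprimePairs Q) := by
  intro p hp q hq h
  obtain ⟨-, h1, h2⟩ := mem_coprimePairs.1 hp
  obtain ⟨-, h3, h4⟩ := mem_coprimePairs.1 hq
  have := Rat.div_int_inj (a := p.2) (b := p.1) (c := q.2) (d := q.1) (by omega) (by omega)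
    (by simpa using h2.symm) (by simpa using h4.symm) (by simpa using h)
  ext
  · exact_mod_cast this.2
  · exact_mod_cast this.1

theorem ncard_saturatedFarey_le (β : ℝ) (Q : ℕ) :
    {x ∈ saturatedFarey Q | (x : ℝ) ∈ Set.Icc (0 : ℝ) β}.ncard ≤ hyperbolicCount β Q + 1 := by
  classical
  rw [hyperbolicCount]
  set F := (coprimePairs Q).filter fun p => inversePoint p 0 ≤ β ∧
    (p.1 : ℝ) * (1 + inversePoint p 0 + inversePoint p 1) ≤ Q with hF
  -- The fraction 1 comes from no pair with d < b, hence the extra element.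
  have hsub : {x ∈ saturatedFarey Q | (x : ℝ) ∈ Set.Icc (0 : ℝ) β} ⊆
      (insert 1 (F.image fun p : ℕ × ℕ => (p.2 : ℚ) / p.1) : Finset ℚ) := by
    rintro x ⟨hx, hxβ⟩
    rw [Finset.coe_insert, Set.mem_insert_iff]
    refine (eq_one_or_exists_of_mem_saturatedFarey hx).imp_right ?_
    rintro ⟨p, hp, hQ, rfl⟩
    refine Finset.mem_coe.2 (Finset.mem_image.2 ⟨p, Finset.mem_filter.2 ⟨hp, ?_, ?_⟩, rfl⟩)
    · simpa [inversePoint] using hxβ.2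
    · rw [mul_one_add_inversePoint hp]
      exact_mod_cast hQ
  refine (Set.ncard_le_ncard hsub (Finset.finite_toSet _)).trans ?_
  rw [Set.ncard_coe_finset]
  exact (Finset.card_insert_le _ _).trans (Nat.add_le_add_right Finset.card_image_le 1)

theorem hyperbolicCount_le_ncard (β : ℝ) (Q : ℕ) :
    hyperbolicCount β Q ≤ {x ∈ saturatedFarey Q | (x : ℝ) ∈ Set.Icc (0 : ℝ) β}.ncard + 1 := by
  classical
  rw [hyperbolicCount]
  set F := (coprimePairs Q).filter fun p => inversePoint p 0 ≤ β ∧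
    (p.1 : ℝ) * (1 + inversePoint p 0 + inversePoint p 1) ≤ Q with hF
  -- The pair (1, 0) would give the fraction 0, which is not saturated; erasing it costs at most 1.
  have hsub : ((F.erase (1, 0)).image (fun p : ℕ × ℕ => (p.2 : ℚ) / p.1) : Set ℚ) ⊆
      {x ∈ saturatedFarey Q | (x : ℝ) ∈ Set.Icc (0 : ℝ) β} := by
    intro x hx
    obtain ⟨p, hp, rfl⟩ := Finset.mem_image.1 (Finset.mem_coe.1 hx)
    obtain ⟨hp1, hp⟩ := Finset.mem_erase.1 hp
    obtain ⟨hp, hβ, hQ⟩ := Finset.mem_filter.1 hp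
    rw [mul_one_add_inversePoint hp] at hQ
    have h2 : 2 ≤ p.1 := by
      by_contra! h
      have := (mem_coprimePairs.1 hp).2.1
      exact hp1 (Prod.ext (by dsimp only; omega) (by dsimp only; omega))
    refine ⟨mem_saturatedFarey hp h2 (by exact_mod_cast hQ), ?_, ?_⟩
    · push_cast; positivity
    · simpa [inversePoint] using hβ
  have h1 := Set.ncard_le_ncard hsub ((saturatedFarey_finite Q).subset fun x hx => hx.1)
  have hcard : ((F.erase (1, 0)).image (fun p : ℕ × ℕ => (p.2 : ℚ) / p.1)).card =
      (F.erase (1, 0)).card := Finset.card_image_of_injOn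
    ((coprimePairs_frac_injOn Q).mono fun p hp =>
      (Finset.mem_filter.1 (Finset.mem_of_mem_erase hp)).1)
  rw [Set.ncard_coe_finset, hcard] at h1
  have := Finset.pred_card_le_card_erase (s := F) (a := (1, 0))
  omega

/-! ### Conclusion: the ratio of the two asymptotics. -/

theorem tendsto_ncard_saturatedFarey_div_sq (β : ℝ) :
    Tendsto (fun Q : ℕ =>
      ({x ∈ saturatedFarey Q | (x : ℝ) ∈ Set.Icc (0 : ℝ) β}.ncard : ℝ) / (Q : ℝ) ^ 2) atTop
      (𝓝 (totientConst * sliceIntegral β)) := by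
  have h0 : Tendsto (fun Q : ℕ => 1 / (Q : ℝ) ^ 2) atTop (𝓝 0) := by
    simpa using (tendsto_one_div_atTop_nhds_zero_nat (𝕜 := ℝ)).pow 2
  have h1 := tendsto_hyperbolicCount β
  have h2 := h1.sub h0
  have h3 := h1.add h0
  rw [sub_zero] at h2
  rw [add_zero] at h3
  refine tendsto_of_tendsto_of_tendsto_of_le_of_le h2 h3 (fun Q => ?_) fun Q => ?_
  · dsimp only
    rw [← sub_div]
    gcongr
    rw [sub_le_iff_le_add]
    exact_mod_cast hyperbolicCount_le_ncard β Q
  · dsimp only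
    rw [← add_div]
    gcongr
    exact_mod_cast ncard_saturatedFarey_le β Q

theorem saturatedFarey_sep_Icc_one (Q : ℕ) :
    {x ∈ saturatedFarey Q | (x : ℝ) ∈ Set.Icc (0 : ℝ) 1} = saturatedFarey Q := by
  refine Set.sep_eq_self_iff_mem_true.2 ?_
  rintro _ ⟨M, ⟨⟨h1, h2, h3, h4, h5⟩, -⟩, rfl⟩
  have hd : (1 : ℝ) ≤ M.1 1 1 := by exact_mod_cast h3
  have hb : (M.1 1 1 : ℝ) ≤ M.1 0 1 := by exact_mod_cast h2
  simp only [fracPsi, Rat.cast_div, Rat.cast_intCast]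
  exact ⟨div_nonneg (by linarith) (by linarith), (div_le_one (by linarith)).2 hb⟩

theorem corollary3 (β : ℝ) (hβ : β ∈ Set.Icc (0 : ℝ) 1) :
    Tendsto
      (fun Q : ℕ =>
        (({x ∈ saturatedFarey Q | (x : ℝ) ∈ Set.Icc (0 : ℝ) β}.ncard : ℕ) : ℝ) /
          ((saturatedFarey Q).ncard : ℝ))
      atTop
      (𝓝 (∫ x in (0 : ℝ)..β, (1 / (1 + x) - 1 / (2 + x)) / Real.log (4 / 3))) := by
  have hlog : Real.log (4 / 3) ≠ 0 := (Real.log_pos (by norm_num)).ne'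
  have h1 := tendsto_ncard_saturatedFarey_div_sq 1
  simp_rw [saturatedFarey_sep_Icc_one, sliceIntegral_one] at h1
  have h := (tendsto_ncard_saturatedFarey_div_sq β).div h1 (mul_ne_zero totientConst_ne_zero hlog)
  rw [mul_div_mul_left _ _ totientConst_ne_zero, sliceIntegral_eq hβ,
    ← intervalIntegral.integral_div] at h
  refine h.congr' ?_
  filter_upwards [eventually_gt_atTop 0] with Q hQ
  have : ((Q : ℝ) ^ 2) ≠ 0 := by positivity
  simp only [Pi.div_apply]
  rw [div_div_div_cancel_right₀ this]
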